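/- Let $\mathbb C_\pm=\{z\in\mathbb C:\pm\operatorname{Im}z>0\}$, $D=\{|z|<1\}$, and $P(x,y)=\frac{y}{x^2+y^2}$. For $2<p\le\infty$, $L^{p,2}(\mathbb C_+)$ is the set of $f:\mathbb C_+\to\mathbb C$ with $f\in L^p(D\cap\mathbb C_+)$ and $f_2\in L^p(D\cap\mathbb C_-)$, where $f_2(z)=|z|^{-2}f(1/z)$. Let $\mathcal H_{tg}$ be the set of holomorphic $h$ on $\mathbb C_+$ for which there are a positive integer $N$ and a constant $C$ with $|h(x+iy)|\le C y^{-N}$ for all $x+iy\in\mathbb C_+$. For $g$ on $\mathbb C_+$ put $\langle g_b,\varphi\rangle=\lim_{y\searrow0}\int_{-\infty}^\infty g(x+iy)\varphi(x)\,dx$ whenever the integrals converge absolutely for small $y>0$ and the limit exists; $g$ has a boundary value $g_b\in\mathcal D'(\mathbb R)$ if this is so for all $\varphi\in C_c^\infty(\mathbb R)$ and defines a distribution. Real and imaginary parts of $g_b$ are given by $\langle\operatorname{Re}g_b,\varphi\rangle=\operatorname{Re}\langle g_b,\varphi\rangle$ and $\langle\operatorname{Im}g_b,\varphi\rangle=\operatorname{Im}\langle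 g_b,\varphi\rangle$ for real-valued $\varphi$. Set $$\mathcal T_{\mathbb C_+}(f)(z)=-\frac1\pi\iint_{\mathbb C_+}\left(f(\zeta)\Big(\frac1{\zeta-z}-\frac{\zeta}{\zeta^2+1}\Big)-\overline{f(\zeta)}\Big(\frac1{\overline\zeta-z}-\frac{\overline\zeta}{\overline\zeta^2+1}\Big)\right)d\xi\,d\eta,\qquad \zeta=\xi+i\eta.$$ **Theorem.** Let $p>2$, $f\in L^{p,2}(\mathbb C_+)$, $h\in\mathcal H_{tg}$ and $c\in\mathbb R$. Then, for every $z=x+iy\in\mathbb C_+$, the integral defining $\mathcal T_{\mathbb C_+}(f)(z)$ converges absolutely, the pairings $\langle h_b,P(x-\cdot,y)\rangle$ and $\langle h_b,P(\cdot,1)\rangle$ exist, and $h(z)=\frac1\pi\langle h_b,P(x-\cdot,y)\rangle$. Let $$w(z)=ic+\frac1\pi\langle h_b,P(x-\cdot,y)\rangle-I+\mathcal T_{\mathbb C_+}(f)(z)=ic+h(z)-I+\mathcal T_{\mathbb C_+}(f)(z),\qquad I=\frac i\pi\langle\operatorname{Im}h_b,P(\cdot,1)\rangle .$$ Then $w$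 is continuous on $\mathbb C_+$, $h$ and $w$ have boundary values $h_b,w_b\in\mathcal D'(\mathbb R)$, and $w$ solves the Schwarz boundary value problem $$\frac{\partial w}{\partial\bar z}=f\ \text{ in }\mathbb C_+,\qquad \operatorname{Re}w_b=\operatorname{Re}h_b,\qquad \operatorname{Im}w(i)=c,$$ where the first equation is understood in the weak sense: $w$ and $f$ are locally integrable in $\mathbb C_+$ and $\iint_{\mathbb C_+} w\,\frac{\partial\varphi}{\partial\bar z}=-\iint_{\mathbb C_+} f\varphi$ for all $\varphi\in C_c^\infty(\mathbb C_+)$. -/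

import Mathlib

open MeasureTheory Filter Topology Complex
open scoped ENNReal Distributions

noncomputable section

namespace SchwarzUHP

/-- The open upper half-plane `ℂ₊`, as a subset of `ℂ`. -/
def upperPlane : Set ℂ := {z | 0 < z.im}

/-- The open lower half-plane `ℂ₋`, as a subset of `ℂ`. -/
def lowerPlane : Set ℂ := {z | z.im < 0}

/-- `f_ν(z) = |z|^(-ν) f(1/z)`. -/
def inversionTwist (ν : ℝ) (f : ℂ → ℂ) (z : ℂ) : ℂ := ((1 / ‖z‖ ^ ν : ℝ) : ℂ) * f (1 / z)

/-- The space `L^{p,ν}(ℂ₊)`: `f ∈ L^p(D ∩ ℂ₊)` and `f_ν ∈ L^p(D ∩ ℂ₋)`, where `D` is the open unit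
disk. Only the values of `f` on `ℂ₊` matter. -/
def MemLpNu (p : ℝ≥0∞) (ν : ℝ) (f : ℂ → ℂ) : Prop :=
  MemLp f p (volume.restrict (Metric.ball 0 1 ∩ upperPlane)) ∧
  MemLp (inversionTwist ν f) p (volume.restrict (Metric.ball 0 1 ∩ lowerPlane))

/-- The space `𝓗_tg` of holomorphic functions on `ℂ₊` with tempered growth at the boundary. -/
def TemperedGrowth (h : ℂ → ℂ) : Prop :=
  DifferentiableOn ℂ h upperPlane ∧
  ∃ N : ℕ, 0 < N ∧ ∃ C : ℝ, ∀ z ∈ upperPlane, ‖h z‖ ≤ C / z.im ^ N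

/-- The Poisson kernel of `ℂ₊` (without the factor `1/π`). -/
def poissonP (x y : ℝ) : ℝ := y / (x ^ 2 + y ^ 2)

/-- The integral `∫ g(x + iy) φ(x) dx` over the horizontal line at height `y`. -/
def linePairing (g : ℂ → ℂ) (φ : ℝ → ℝ) (y : ℝ) : ℂ :=
  ∫ x : ℝ, g ((x : ℂ) + (y : ℂ) * I) * (φ x : ℂ)

/-- `⟨g_b, φ⟩` exists and equals `ℓ`: the integrals `∫ g(x + iy) φ(x) dx` converge absolutely for
all small `y > 0` and tend to `ℓ` as `y ↘ 0`. -/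
def HasBoundaryPairing (g : ℂ → ℂ) (φ : ℝ → ℝ) (ℓ : ℂ) : Prop :=
  (∀ᶠ y : ℝ in 𝓝[>] 0, Integrable (fun x : ℝ => g ((x : ℂ) + (y : ℂ) * I) * (φ x : ℂ))) ∧
  Tendsto (linePairing g φ) (𝓝[>] 0) (𝓝 ℓ)

/-- The number `⟨g_b, φ⟩ = lim_{y ↘ 0} ∫ g(x + iy) φ(x) dx`; meaningful when
`HasBoundaryPairing g φ ℓ` holds for some `ℓ`, which is then its value. -/
def boundaryPairing (g : ℂ → ℂ) (φ : ℝ → ℝ) : ℂ := limUnder (𝓝[>] 0) (linePairing g φ)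

/-- The distribution `T` on `ℝ` is the boundary value `g_b` of `g`. A complex distribution is given
by its values on real test functions, to which it is equivalent by complex linearity. -/
def IsBoundaryValue (g : ℂ → ℂ) (T : 𝓓'((⊤ : TopologicalSpace.Opens ℝ), ℂ)) : Prop :=
  ∀ φ : 𝓓((⊤ : TopologicalSpace.Opens ℝ), ℝ), HasBoundaryPairing g φ (T φ)

/-- The real part of a complex distribution: `⟨Re T, φ⟩ = Re ⟨T, φ⟩` for real `φ`. -/
def distribRe (T : 𝓓'((⊤ : TopologicalSpace.Opens ℝ), ℂ)) :
    𝓓'((⊤ : TopologicalSpace.Opens ℝ), ℝ) :=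
  Distribution.mapCLM Complex.reCLM T

/-- The integrand, as a function of `ζ`, of the operator `𝒯_{ℂ₊}` at the point `z`. -/
def schwarzKernel (f : ℂ → ℂ) (z ζ : ℂ) : ℂ :=
  f ζ * (1 / (ζ - z) - ζ / (ζ ^ 2 + 1)) -
    (starRingEnd ℂ) (f ζ) * (1 / ((starRingEnd ℂ) ζ - z) -
      (starRingEnd ℂ) ζ / (((starRingEnd ℂ) ζ) ^ 2 + 1))

/-- The operator `𝒯_{ℂ₊}`. -/
def schwarzT (f : ℂ → ℂ) (z : ℂ) : ℂ :=
  -(1 / (Real.pi : ℂ)) * ∫ ζ in upperPlane, schwarzKernel f z ζ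

/-- The operator `∂/∂z̄ = (∂/∂x + i ∂/∂y) / 2` on (real-)differentiable functions. -/
def dbar (φ : ℂ → ℂ) (z : ℂ) : ℂ := (1 / 2 : ℂ) * (fderiv ℝ φ z 1 + I * fderiv ℝ φ z I)

/-- `∂w/∂z̄ = f` in `ℂ₊` in the generalized (weak) sense: `w` and `f` are locally integrable and
`∬ w ∂φ/∂z̄ = - ∬ f φ` for all smooth `φ` with compact support in `ℂ₊`. -/
def HasWeakDbar (w f : ℂ → ℂ) : Prop :=
  LocallyIntegrableOn w upperPlane ∧ LocallyIntegrableOn f upperPlane ∧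
  ∀ φ : ℂ → ℂ, ContDiff ℝ (⊤ : ℕ∞) φ → HasCompactSupport φ → tsupport φ ⊆ upperPlane →
    ∫ z in upperPlane, w z * dbar φ z = -∫ z in upperPlane, f z * φ z

/-- `w` solves the Schwarz boundary value problem `∂w/∂z̄ = f`, `Re w_b = Re h_b`, `Im w(i) = c`.
Continuity in `ℂ₊` makes the point evaluation at `i` independent of the choice of representative;
the existence of both boundary values is part of the condition. -/
structure IsSchwarzSolution (f h : ℂ → ℂ) (c : ℝ) (w : ℂ → ℂ) : Prop where
  continuousOn : ContinuousOn w upperPlane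
  dbar_eq : HasWeakDbar w f
  re_boundary : ∃ wb hb : 𝓓'((⊤ : TopologicalSpace.Opens ℝ), ℂ),
    IsBoundaryValue w wb ∧ IsBoundaryValue h hb ∧ distribRe wb = distribRe hb
  im_at_I : (w I).im = c

/-- `(1/π) ⟨h_b, P(x - ·, y)⟩`, where `z = x + iy`. -/
def poissonOfBoundary (h : ℂ → ℂ) (z : ℂ) : ℂ :=
  (1 / (Real.pi : ℂ)) * boundaryPairing h (fun t => poissonP (z.re - t) z.im)

/-- The constant `(i/π) ⟨Im h_b, P(·, 1)⟩`, where `⟨Im h_b, φ⟩ = Im ⟨h_b, φ⟩` for real `φ`. -/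
def imCorrection (h : ℂ → ℂ) : ℂ :=
  (I / (Real.pi : ℂ)) * ((boundaryPairing h (fun t => poissonP t 1)).im : ℂ)

/-- The function `ic + (1/π)⟨h_b, P(x - ·, y)⟩ - (i/π)⟨Im h_b, P(·, 1)⟩ + 𝒯_{ℂ₊}(f)(z)`. -/
def schwarzSolution (f h : ℂ → ℂ) (c : ℝ) (z : ℂ) : ℂ :=
  I * (c : ℂ) + poissonOfBoundary h z - imCorrection h + schwarzT f z

end SchwarzUHP

end

/-! Each term of the formula has one task: `schwarzT f` solves the inhomogeneous equation, is purely
imaginary on the real line and real at i; h carries the boundary datum; the imaginary constants fix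
the value at i without touching real parts.

Inversion turns the hypothesis on f into two facts on ℂ₊: f is in L^q for some real q > 2, and (1 +
|ζ|²)⁻¹ f is integrable (`MemLpNu.exists_density`). Let F be f extended by zero and F*(ζ) the
conjugate of F at the conjugate point. The compensated kernel K(z, ζ) has Cauchy singularities at
finite distance and is O(|ζ|⁻²) at infinity, so its potential P_F converges for every z and is
continuous on all of ℂ (`PotentialDensity.continuous_potential`). Moreover `schwarzT f` = -(1/π)(P_F
- P_F*). The potential of F* is the reflection of P_F, so the difference is imaginary on ℝ; and
K(-i, ζ) = -K(i, ζ) makes it real at i. Fubini and the Cauchy–Pompeiu formula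
(`integral_dbar_mul_inv`) give ∂P_G/∂z̄ = -πG weakly, and F* vanishes on ℂ₊.

For h, each translate h(· + is), s > 0, is bounded and holomorphic past the real line, so a contour
integral yields its Poisson formula (`integral_mul_poissonP`); letting s ↘ 0 gives the pairings and
the representation of h. For the distributional boundary value, put L_φ(s) = ∫ h(x + is) φ(x) dx.
The Cauchy–Riemann equations give L_φ' = -i L_{φ'}. Weighting by (s - y)^N absorbs the growth
s^(-N), so the weighted height integrals converge; integration by parts in s lowers the power one
step at a time, each step costing a derivative of φ. The remaining part of w is continuous up to ℝ,
so its boundary value is its restriction there. -/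

namespace SchwarzUHP

/-! ### Inversion, and what membership in L^{p,2} provides on ℂ₊ -/

lemma measurableSet_upperPlane : MeasurableSet upperPlane :=
  measurableSet_lt measurable_const Complex.measurable_im

lemma measurableSet_lowerPlane : MeasurableSet lowerPlane :=
  measurableSet_lt Complex.measurable_im measurable_const

lemma isOpen_upperPlane : IsOpen upperPlane := isOpen_lt continuous_const Complex.continuous_im

/-- The set mapped by `z ↦ z⁻¹` onto the exterior of the unit disk in `ℂ₊`. -/
abbrev lowerHalfDisk : Set ℂ := Metric.ball 0 1 ∩ lowerPlane

lemma ne_zero_of_mem_lowerHalfDisk {z : ℂ} (hz : z ∈ lowerHalfDisk) : z ≠ 0 := by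
  rintro rfl
  simpa [lowerPlane] using hz.2

lemma inv_image_lowerHalfDisk :
    (fun z : ℂ => z⁻¹) '' lowerHalfDisk = {z | 1 < ‖z‖} ∩ upperPlane := by
  ext z
  constructor
  · rintro ⟨u, hu, rfl⟩
    have hu0 := ne_zero_of_mem_lowerHalfDisk hu
    refine ⟨?_, ?_⟩
    · have : ‖u‖ < 1 := by simpa using hu.1
      simpa using (one_lt_inv₀ (norm_pos_iff.2 hu0)).2 this
    · have : u.im < 0 := hu.2
      simp only [upperPlane, Set.mem_ofPred_eq, Complex.inv_im]
      exact div_pos (by linarith) (Complex.normSq_pos.2 hu0)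
  · rintro ⟨hz, hz'⟩
    have hz0 : z ≠ 0 := by
      rintro rfl
      simp [upperPlane] at hz'
    refine ⟨z⁻¹, ⟨?_, ?_⟩, inv_inv z⟩
    · simpa using inv_lt_one_of_one_lt₀ hz
    · have : 0 < z.im := hz'
      simp only [lowerPlane, Set.mem_ofPred_eq, Complex.inv_im]
      exact div_neg_of_neg_of_pos (by linarith) (Complex.normSq_pos.2 hz0)

/-- The real determinant of multiplication by a is the field norm of ℂ over ℝ. This supplies the
Jacobian of the inversion. -/
lemma abs_det_mul_restrictScalars (a : ℂ) :
    |((ContinuousLinearMap.toSpanSingleton ℂ a).restrictScalars ℝ).det| = ‖a‖ ^ 2 := by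
  have h : (((ContinuousLinearMap.toSpanSingleton ℂ a).restrictScalars ℝ : ℂ →L[ℝ] ℂ) : ℂ →ₗ[ℝ] ℂ)
      = Algebra.lmul ℝ ℂ a := by
    ext
    simp [mul_comm]
  have h2 : ((ContinuousLinearMap.toSpanSingleton ℂ a).restrictScalars ℝ).det
      = Algebra.norm ℝ a := by
    rw [ContinuousLinearMap.det, h]
    rfl
  rw [h2, Algebra.norm_complex_eq]
  simp [Complex.normSq_eq_norm_sq]

/-- Change of variables ζ = 1/u: the derivative is -u⁻², so the real Jacobian is |u|⁻⁴. -/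
lemma integrableOn_exterior_iff {F : Type*} [NormedAddCommGroup F] [NormedSpace ℝ F] (k : ℂ → F) :
    IntegrableOn k ({z | 1 < ‖z‖} ∩ upperPlane) ↔
      IntegrableOn (fun u => (‖u‖ ^ 4)⁻¹ • k u⁻¹) lowerHalfDisk := by
  have hm : MeasurableSet lowerHalfDisk := measurableSet_ball.inter measurableSet_lowerPlane
  rw [← inv_image_lowerHalfDisk,
    integrableOn_image_iff_integrableOn_abs_det_fderiv_smul volume hm
      (f' := fun u => (ContinuousLinearMap.toSpanSingleton ℂ (-(u ^ 2)⁻¹)).restrictScalars ℝ)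
      (fun u hu => ((hasDerivAt_inv
        (ne_zero_of_mem_lowerHalfDisk hu)).hasFDerivAt.restrictScalars ℝ).hasFDerivWithinAt)
      (fun a _ b _ hab => inv_injective hab)]
  simp only [abs_det_mul_restrictScalars]
  simp [← pow_mul]

lemma norm_inversionTwist_two (f : ℂ → ℂ) (u : ℂ) :
    ‖inversionTwist 2 f u‖ = (‖u‖ ^ 2)⁻¹ * ‖f u⁻¹‖ := by
  simp [inversionTwist]

lemma upperPlane_ae_subset :
    upperPlane ≤ᵐ[volume] ((Metric.ball 0 1 ∩ upperPlane) ∪ ({z : ℂ | 1 < ‖z‖} ∩ upperPlane) :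
      Set ℂ) := by
  have h0 : volume (Metric.sphere (0 : ℂ) 1) = 0 := Measure.addHaar_sphere _ _ _
  filter_upwards [compl_mem_ae_iff.2 h0] with z hz hzu
  have hz' : ‖z‖ ≠ 1 := by simpa using hz
  rcases lt_or_gt_of_ne hz' with h | h
  · exact Or.inl ⟨by simpa using h, hzu⟩
  · exact Or.inr ⟨h, hzu⟩

lemma exists_real_exponent {p : ℝ≥0∞} (hp : 2 < p) : ∃ q : ℝ, 2 < q ∧ ENNReal.ofReal q ≤ p := by
  obtain ⟨r, hr, hrp⟩ := ENNReal.lt_iff_exists_nnreal_btwn.1 hp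
  refine ⟨r, ?_, ?_⟩
  · have : ((2 : NNReal) : ℝ≥0∞) < r := by simpa using hr
    exact_mod_cast this
  · simpa using hrp.le

/-- The integrability that membership in `L^{p,2}(ℂ₊)`, `p > 2`, provides. -/
structure PotentialDensity (q : ℝ) (g : ℂ → ℂ) (S : Set ℂ) : Prop where
  aesm : AEStronglyMeasurable g (volume.restrict S)
  rpow : IntegrableOn (fun ζ => ‖g ζ‖ ^ q) S
  weighted : IntegrableOn (fun ζ => (1 + ‖ζ‖ ^ 2)⁻¹ * ‖g ζ‖) S

/-- The half-disks have finite measure, so p may be lowered to a real q > 2, which also covers p =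
∞. Outside the disk, inversion turns |ζ|⁻²|f| into exactly |f_2|, and |f|^q into |u|⁻⁴|f(1/u)|^q,
which is dominated by |f_2|^q. -/
lemma MemLpNu.exists_density {p : ℝ≥0∞} (hp : 2 < p) {f : ℂ → ℂ} (hf : MemLpNu p 2 f) :
    ∃ q : ℝ, 2 < q ∧ PotentialDensity q f upperPlane := by
  obtain ⟨q, hq, hqp⟩ := exists_real_exponent hp
  have hq0 : 0 < q := by linarith
  have hfin : ∀ S : Set ℂ, IsFiniteMeasure (volume.restrict (Metric.ball (0 : ℂ) 1 ∩ S)) := by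
    intro S
    refine ⟨?_⟩
    rw [Measure.restrict_apply_univ]
    exact (measure_mono Set.inter_subset_left).trans_lt measure_ball_lt_top
  have := hfin upperPlane
  have := hfin lowerPlane
  have h1 := hf.1.mono_exponent hqp
  have h2 := hf.2.mono_exponent hqp
  have hq1 : (1 : ℝ≥0∞) ≤ ENNReal.ofReal q := by
    rw [ENNReal.one_le_ofReal]; linarith
  have hne0 : ENNReal.ofReal q ≠ 0 := by simpa using hq0
  have i1 := h1.integrable hq1
  have i2 := h2.integrable hq1
  have r1 := h1.integrable_norm_rpow hne0 ENNReal.ofReal_ne_top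
  have r2 := h2.integrable_norm_rpow hne0 ENNReal.ofReal_ne_top
  rw [ENNReal.toReal_ofReal hq0.le] at r1 r2
  have hmL : MeasurableSet lowerHalfDisk := measurableSet_ball.inter measurableSet_lowerPlane
  have hmE : MeasurableSet ({z : ℂ | 1 < ‖z‖} ∩ upperPlane) :=
    (measurableSet_lt measurable_const measurable_norm).inter measurableSet_upperPlane
  -- measurability and weighted integrability on the exterior
  have e1 : IntegrableOn (fun ζ => ((‖ζ‖ ^ 2)⁻¹ : ℝ) • f ζ) ({z | 1 < ‖z‖} ∩ upperPlane) := by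
    rw [integrableOn_exterior_iff]
    refine IntegrableOn.congr_fun (f := inversionTwist 2 f) i2 (fun u hu => ?_) hmL
    have hu0 : ‖u‖ ≠ 0 := norm_ne_zero_iff.2 (ne_zero_of_mem_lowerHalfDisk hu)
    rw [inversionTwist, smul_smul, norm_inv, inv_pow, inv_inv, one_div, one_div, Real.rpow_ofNat,
      ← Complex.real_smul]
    congr 1
    field_simp
  have m2 : AEStronglyMeasurable f (volume.restrict ({z | 1 < ‖z‖} ∩ upperPlane)) := by
    have : AEStronglyMeasurable (fun ζ : ℂ => (‖ζ‖ ^ 2 : ℝ) • (((‖ζ‖ ^ 2)⁻¹ : ℝ) • f ζ))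
        (volume.restrict ({z | 1 < ‖z‖} ∩ upperPlane)) :=
      (show Continuous fun ζ : ℂ => (‖ζ‖ ^ 2 : ℝ) by fun_prop).aestronglyMeasurable.smul
        e1.aestronglyMeasurable
    refine this.congr ?_
    filter_upwards [ae_restrict_mem hmE] with z hz
    have : ‖z‖ ≠ 0 := (lt_trans one_pos hz.1).ne'
    rw [smul_smul, mul_inv_cancel₀ (pow_ne_zero 2 this), one_smul]
  have mf : AEStronglyMeasurable f (volume.restrict upperPlane) :=
    (aestronglyMeasurable_union_iff.2 ⟨h1.1, m2⟩).mono_measure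
      (Measure.restrict_mono_ae upperPlane_ae_subset)
  have e2 : IntegrableOn (fun ζ => ‖f ζ‖ ^ q) ({z | 1 < ‖z‖} ∩ upperPlane) := by
    rw [integrableOn_exterior_iff]
    have m4 : AEStronglyMeasurable (fun u => f u⁻¹) (volume.restrict lowerHalfDisk) := by
      have : AEStronglyMeasurable (fun u : ℂ => (‖u‖ ^ 2 : ℝ) • (inversionTwist 2 f u))
          (volume.restrict lowerHalfDisk) :=
        (show Continuous fun ζ : ℂ => (‖ζ‖ ^ 2 : ℝ) by fun_prop).aestronglyMeasurable.smul h2.1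
      refine this.congr ?_
      filter_upwards [ae_restrict_mem hmL] with u hu
      have hu0 : (‖u‖ : ℂ) ≠ 0 := by
        exact_mod_cast norm_ne_zero_iff.2 (ne_zero_of_mem_lowerHalfDisk hu)
      simp only [inversionTwist, Complex.real_smul, one_div, Real.rpow_ofNat]
      push_cast
      field_simp
    refine Integrable.mono' r2 ?_ ?_
    · refine AEStronglyMeasurable.smul (f := fun u : ℂ => (‖u‖ ^ 4)⁻¹)
        (Measurable.aestronglyMeasurable (by fun_prop)) ?_
      exact (m4.norm.aemeasurable.pow_const q).aestronglyMeasurable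
    · filter_upwards [ae_restrict_mem hmL] with u hu
      have hu0 : 0 < ‖u‖ := norm_pos_iff.2 (ne_zero_of_mem_lowerHalfDisk hu)
      have hu1 : ‖u‖ < 1 := by simpa using hu.1
      rw [norm_inversionTwist_two, Real.mul_rpow (by positivity) (by positivity), norm_smul,
        Real.norm_of_nonneg (by positivity), Real.norm_of_nonneg (by positivity)]
      refine mul_le_mul_of_nonneg_right ?_ (by positivity)
      have h4 : (‖u‖ ^ 4)⁻¹ = ((‖u‖ ^ 2)⁻¹) ^ (2 : ℝ) := by
        rw [Real.rpow_ofNat, inv_pow, ← pow_mul]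
      rw [h4]
      -- Here |u|⁻⁴ ≤ |u|^(-2q), because |u| < 1 and q > 2.
      exact Real.rpow_le_rpow_of_exponent_le
        ((one_le_inv₀ (by positivity)).2 (pow_le_one₀ hu0.le hu1.le)) hq.le
  have hw : AEStronglyMeasurable (fun ζ : ℂ => (1 + ‖ζ‖ ^ 2)⁻¹ * ‖f ζ‖)
      (volume.restrict upperPlane) :=
    (Measurable.aestronglyMeasurable (by fun_prop)).mul mf.norm
  have e3 : IntegrableOn (fun ζ => (1 + ‖ζ‖ ^ 2)⁻¹ * ‖f ζ‖) ({z | 1 < ‖z‖} ∩ upperPlane) := by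
    refine Integrable.mono' e1.norm
      (hw.mono_measure (Measure.restrict_mono Set.inter_subset_right le_rfl)) ?_
    filter_upwards [ae_restrict_mem hmE] with z hz
    have : (0 : ℝ) < ‖z‖ := lt_trans one_pos hz.1
    rw [norm_smul, norm_mul, norm_norm, Real.norm_of_nonneg (by positivity),
      Real.norm_of_nonneg (by positivity)]
    gcongr
    linarith
  have e4 : IntegrableOn (fun ζ => (1 + ‖ζ‖ ^ 2)⁻¹ * ‖f ζ‖) (Metric.ball 0 1 ∩ upperPlane) := by
    refine Integrable.mono' i1.norm
      (hw.mono_measure (Measure.restrict_mono Set.inter_subset_right le_rfl)) ?_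
    refine Eventually.of_forall fun z => ?_
    rw [norm_mul, norm_norm, Real.norm_of_nonneg (by positivity)]
    refine mul_le_of_le_one_left (norm_nonneg _) (inv_le_one_of_one_le₀ ?_)
    nlinarith [norm_nonneg z]
  exact ⟨q, hq, mf, (IntegrableOn.union r1 e2).mono_set_ae upperPlane_ae_subset,
    (e4.union e3).mono_set_ae upperPlane_ae_subset⟩

/-! ### Uniform bounds for weak singularities; Hölder continuity of the Cauchy transform -/

lemma integrableOn_ball_norm_rpow {t : ℝ} (ht : t < 2) :
    IntegrableOn (fun u : ℂ => ‖u‖ ^ (-t)) (Metric.ball 0 1) := by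
  rw [integrableOn_fun_norm_addHaar volume (f := fun r : ℝ => r ^ (-t)) (r := 1)]
  have h : IntegrableOn (fun y : ℝ => y ^ (1 - t)) (Set.Ioo 0 1) := by
    have := (intervalIntegral.intervalIntegrable_rpow' (a := 0) (b := 1) (r := 1 - t) (by linarith))
    rw [intervalIntegrable_iff_integrableOn_Ioo_of_le zero_le_one] at this
    exact this
  refine h.congr_fun (fun y hy => ?_) measurableSet_Ioo
  simp only [Complex.finrank_real_complex, smul_eq_mul]
  rw [sub_eq_add_neg, Real.rpow_add hy.1]
  simp

/-- The truncated singularity `|u|^(-t) 1_{|u| < 1}`. -/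
noncomputable def truncSing (t : ℝ) (u : ℂ) : ℝ :=
  (Metric.ball (0 : ℂ) 1).indicator (fun u => ‖u‖ ^ (-t)) u

lemma truncSing_nonneg (t : ℝ) (u : ℂ) : 0 ≤ truncSing t u :=
  Set.indicator_nonneg (fun _ _ => by positivity) _

lemma integrable_truncSing {t : ℝ} (ht : t < 2) : Integrable (truncSing t) :=
  (integrable_indicator_iff measurableSet_ball).2 (integrableOn_ball_norm_rpow ht)

/-- Young's inequality inside the unit disk, and |u|^(-s) ≤ 1 outside. This pointwise form replaces
Hölder's inequality for integrals. -/
lemma mul_norm_rpow_le {q q' s : ℝ} (hq : q.HolderConjugate q') (hs : 0 < s) {a : ℝ} (ha : 0 ≤ a)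
    (u : ℂ) : a * ‖u‖ ^ (-s) ≤ a + a ^ q + truncSing (s * q') u := by
  by_cases hu : ‖u‖ < 1
  · have h1 : truncSing (s * q') u = (‖u‖ ^ (-s)) ^ q' := by
      rw [truncSing, Set.indicator_of_mem (by simpa using hu), ← Real.rpow_mul (norm_nonneg _)]
      ring_nf
    have h2 := Real.young_inequality_of_nonneg ha
      (b := ‖u‖ ^ (-s)) (by positivity) hq
    have h3 : a ^ q / q ≤ a ^ q := div_le_self (by positivity) hq.lt.le
    have h4 : (‖u‖ ^ (-s)) ^ q' / q' ≤ (‖u‖ ^ (-s)) ^ q' :=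
      div_le_self (by positivity) hq.symm.lt.le
    linarith
  · have h1 : ‖u‖ ^ (-s) ≤ 1 := Real.rpow_le_one_of_one_le_of_nonpos (not_lt.1 hu) (by linarith)
    have h2 : 0 ≤ a ^ q := by positivity
    nlinarith [truncSing_nonneg (s * q') u]

/-- The singular majorant is a translate of one integrable function (integrable because s q' < 2),
so its integral does not depend on z. -/
lemma exists_singular_bound {q q' s : ℝ} (hq : q.HolderConjugate q') (hs : 0 < s)
    (hsq : s * q' < 2) {g : ℂ → ℂ} (hg : Integrable g) (hgq : Integrable fun ζ => ‖g ζ‖ ^ q) :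
    ∃ C : ℝ, ∀ z : ℂ, Integrable (fun ζ => ‖g ζ‖ * ‖ζ - z‖ ^ (-s)) ∧
      ∫ ζ, ‖g ζ‖ * ‖ζ - z‖ ^ (-s) ≤ C := by
  refine ⟨(∫ ζ, (‖g ζ‖ + ‖g ζ‖ ^ q)) + ∫ ζ, truncSing (s * q') ζ, fun z => ?_⟩
  have i1 : Integrable fun ζ => truncSing (s * q') (ζ - z) :=
    (integrable_truncSing hsq).comp_sub_right z
  have i2 : Integrable fun ζ => ‖g ζ‖ + ‖g ζ‖ ^ q := hg.norm.add hgq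
  have hle : ∀ ζ, ‖g ζ‖ * ‖ζ - z‖ ^ (-s) ≤ (‖g ζ‖ + ‖g ζ‖ ^ q) + truncSing (s * q') (ζ - z) :=
    fun ζ => mul_norm_rpow_le hq hs (norm_nonneg _) _
  have i3 : Integrable (fun ζ => ‖g ζ‖ * ‖ζ - z‖ ^ (-s)) := by
    refine Integrable.mono' (i2.add i1) ?_ (Eventually.of_forall fun ζ => ?_)
    · exact hg.1.norm.mul (Measurable.aestronglyMeasurable (by fun_prop))
    · rw [Real.norm_of_nonneg (by positivity)]
      exact hle ζ
  refine ⟨i3, ?_⟩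
  calc ∫ ζ, ‖g ζ‖ * ‖ζ - z‖ ^ (-s)
      ≤ ∫ ζ, ((‖g ζ‖ + ‖g ζ‖ ^ q) + truncSing (s * q') (ζ - z)) :=
        integral_mono i3 (i2.add i1) hle
    _ = _ := by
      rw [integral_add i2 i1, integral_sub_right_eq_self (fun ζ => truncSing (s * q') ζ)]

/-- With a = |ζ - z|, b = |ζ - w| and d = |z - w|, the left side is the modulus of the difference of
two Cauchy kernels. Splitting d = d^α d^(1-α) and bounding the second factor by the larger of a, b
trades the factor d^α for singularities of order 1 + α. -/
lemma norm_inv_sub_inv_le {α a b d : ℝ} (hα : 0 < α) (hα1 : α ≤ 1) (ha : 0 < a) (hb : 0 < b)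
    (hd : 0 ≤ d) (hdab : d ≤ a + b) :
    d / (a * b) ≤ d ^ α * (2 * (a ^ (-(1 + α)) + b ^ (-(1 + α)))) := by
  wlog hab : a ≤ b generalizing a b
  · have := this hb ha (by linarith) (by linarith)
    rwa [mul_comm b a, add_comm (b ^ _)] at this
  have h1 : d = d ^ α * d ^ (1 - α) := by
    rcases hd.eq_or_lt with rfl | hd
    · rw [Real.zero_rpow hα.ne', zero_mul]
    · rw [← Real.rpow_add hd]; simp
  have h2 : d ^ (1 - α) ≤ 2 * b ^ (1 - α) := by
    calc d ^ (1 - α) ≤ (2 * b) ^ (1 - α) :=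
          Real.rpow_le_rpow hd (by linarith) (by linarith)
      _ = 2 ^ (1 - α) * b ^ (1 - α) := Real.mul_rpow (by norm_num) hb.le
      _ ≤ 2 * b ^ (1 - α) := by
          gcongr
          calc (2 : ℝ) ^ (1 - α) ≤ 2 ^ (1 : ℝ) :=
                Real.rpow_le_rpow_of_exponent_le (by norm_num) (by linarith)
            _ = 2 := by simp
  have h3 : b ^ (1 - α) = b * b ^ (-α) := by
    rw [sub_eq_add_neg, Real.rpow_add hb, Real.rpow_one]
  have h4 : b ^ (-α) ≤ a ^ (-α) := Real.rpow_le_rpow_of_nonpos ha hab (by linarith)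
  have h5 : a ^ (-(1 + α)) = a⁻¹ * a ^ (-α) := by
    rw [neg_add, Real.rpow_add ha, Real.rpow_neg_one]
  have hdα : 0 ≤ d ^ α := Real.rpow_nonneg hd _
  calc d / (a * b) = d ^ α * (d ^ (1 - α) * (a⁻¹ * b⁻¹)) := by
        rw [div_eq_mul_inv, mul_inv]
        nth_rewrite 1 [h1]
        ring
    _ ≤ d ^ α * (2 * b ^ (1 - α) * (a⁻¹ * b⁻¹)) := by gcongr
    _ = d ^ α * (2 * (a⁻¹ * b ^ (-α))) := by
        rw [h3]; field_simp
    _ ≤ d ^ α * (2 * (a ^ (-(1 + α)) + b ^ (-(1 + α)))) := by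
        rw [h5]
        gcongr
        have : 0 ≤ b ^ (-(1 + α)) := by positivity
        have : a⁻¹ * b ^ (-α) ≤ a⁻¹ * a ^ (-α) := by gcongr
        linarith

/-- The Cauchy transform of an integrable function in `L^q`, `q > 2`, is Hölder continuous. -/
lemma continuous_cauchyTransform {q q' : ℝ} (hq : q.HolderConjugate q') (hq' : q' < 2) {g : ℂ → ℂ}
    (hg : Integrable g) (hgq : Integrable fun ζ => ‖g ζ‖ ^ q) :
    Continuous fun z => ∫ ζ, g ζ * (1 / (ζ - z)) := by
  have hq1 : 1 < q' := hq.symm.lt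
  -- The excess s - 1 will be the Hölder exponent; q' < 2 leaves room for s > 1 with s q' < 2.
  obtain ⟨s, hs1, hs2⟩ : ∃ s : ℝ, 1 < s ∧ s < 2 / q' :=
    exists_between (by rw [lt_div_iff₀ (by linarith)]; linarith)
  have hsq : s * q' < 2 := by rwa [lt_div_iff₀ (by linarith)] at hs2
  have hs3 : s < 2 := by nlinarith
  obtain ⟨C, hC⟩ := exists_singular_bound hq (by linarith) hsq hg hgq
  obtain ⟨C₁, hC₁⟩ := exists_singular_bound hq one_pos (by linarith) hg hgq
  have hint : ∀ z, Integrable fun ζ => g ζ * (1 / (ζ - z)) := by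
    intro z
    refine Integrable.mono' (hC₁ z).1 (hg.1.mul (Measurable.aestronglyMeasurable (by fun_prop)))
      (Eventually.of_forall fun ζ => ?_)
    rw [norm_mul, norm_div, norm_one, Real.rpow_neg_one, one_div]
  set α := s - 1 with hα
  have hs : s = 1 + α := by ring
  have hbound : ∀ z w : ℂ, ‖(∫ ζ, g ζ * (1 / (ζ - z))) - ∫ ζ, g ζ * (1 / (ζ - w))‖
      ≤ ‖z - w‖ ^ α * (2 * (C + C)) := by
    intro z w
    rw [← integral_sub (hint z) (hint w)]
    have i : Integrable fun ζ => ‖z - w‖ ^ α *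
        (2 * (‖g ζ‖ * ‖ζ - z‖ ^ (-s) + ‖g ζ‖ * ‖ζ - w‖ ^ (-s))) :=
      (((hC z).1.add (hC w).1).const_mul 2).const_mul _
    calc _ ≤ ∫ ζ, ‖z - w‖ ^ α * (2 * (‖g ζ‖ * ‖ζ - z‖ ^ (-s) + ‖g ζ‖ * ‖ζ - w‖ ^ (-s))) := by
          refine norm_integral_le_of_norm_le i ?_
          filter_upwards [compl_mem_ae_iff.2 (measure_singleton z),
            compl_mem_ae_iff.2 (measure_singleton w)] with ζ hz hw
          have hz0 : ζ - z ≠ 0 := sub_ne_zero.2 hz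
          have hw0 : ζ - w ≠ 0 := sub_ne_zero.2 hw
          have e : g ζ * (1 / (ζ - z)) - g ζ * (1 / (ζ - w))
              = g ζ * ((z - w) / ((ζ - z) * (ζ - w))) := by
            field_simp
            ring
          rw [e, norm_mul, norm_div, norm_mul]
          have := norm_inv_sub_inv_le (α := α) (d := ‖z - w‖) (by linarith) (by linarith)
            (norm_pos_iff.2 hz0)
            (norm_pos_iff.2 hw0) (norm_nonneg _) (by
              have : z - w = -(ζ - z) + (ζ - w) := by ring
              rw [this]
              exact (norm_add_le _ _).trans (by rw [norm_neg]))
          rw [← hs] at this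
          calc _ ≤ ‖g ζ‖ * (‖z - w‖ ^ α * (2 * (‖ζ - z‖ ^ (-s) + ‖ζ - w‖ ^ (-s)))) := by gcongr
            _ = _ := by ring
      _ = ‖z - w‖ ^ α * (2 * ((∫ ζ, ‖g ζ‖ * ‖ζ - z‖ ^ (-s)) + ∫ ζ, ‖g ζ‖ * ‖ζ - w‖ ^ (-s))) := by
          rw [integral_const_mul, integral_const_mul, integral_add (hC z).1 (hC w).1]
      _ ≤ _ := by
          gcongr
          · exact (hC z).2
          · exact (hC w).2
  rw [continuous_iff_continuousAt]
  intro w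
  rw [ContinuousAt, tendsto_iff_norm_sub_tendsto_zero]
  refine squeeze_zero (fun _ => norm_nonneg _) (fun z => hbound z w) ?_
  have h0 : Tendsto (fun z : ℂ => ‖z - w‖) (𝓝 w) (𝓝 0) := by
    have : Continuous fun z : ℂ => ‖z - w‖ := by fun_prop
    simpa using this.tendsto w
  have h1 := h0.rpow_const (p := α) (Or.inr (by linarith))
  rw [Real.zero_rpow (by linarith)] at h1
  simpa using h1.mul_const (2 * (C + C))

/-! ### The compensated potential on the whole plane -/

/-- The kernel `1/(ζ - z) - ζ/(ζ² + 1)`. -/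
noncomputable def potentialKernel (z ζ : ℂ) : ℂ := 1 / (ζ - z) - ζ / (ζ ^ 2 + 1)

/-- The potential `∬ g(ζ) (1/(ζ - z) - ζ/(ζ² + 1)) dξ dη` over the whole plane. -/
noncomputable def potential (g : ℂ → ℂ) (z : ℂ) : ℂ := ∫ ζ, g ζ * potentialKernel z ζ

lemma measurable_potentialKernel : Measurable (Function.uncurry potentialKernel) := by
  unfold potentialKernel Function.uncurry
  fun_prop

/-- By partial fractions the compensating term is a mean of Cauchy kernels at ±i. Its pole at i lies
inside ℂ₊, so it needs the same treatment as the pole at z. -/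
lemma norm_div_sq_add_one_le (ζ : ℂ) :
    ‖ζ / (ζ ^ 2 + 1)‖ ≤ ‖ζ - I‖ ^ (-(1 : ℝ)) + ‖ζ - -I‖ ^ (-(1 : ℝ)) := by
  rw [Real.rpow_neg_one, Real.rpow_neg_one]
  have hf : ζ ^ 2 + 1 = (ζ - I) * (ζ - -I) := by
    linear_combination I_sq
  -- At the poles the quotient has the default value 0.
  by_cases h : ζ ^ 2 + 1 = 0
  · rw [h, div_zero, norm_zero]; positivity
  · rw [hf] at h
    have h1 := left_ne_zero_of_mul h
    have h2 := right_ne_zero_of_mul h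
    have e : ζ / (ζ ^ 2 + 1) = (1 / 2) * ((ζ - I)⁻¹ + (ζ - -I)⁻¹) := by
      rw [hf]; field_simp; ring
    rw [e, norm_mul]
    have := norm_add_le (ζ - I)⁻¹ (ζ - -I)⁻¹
    rw [norm_inv, norm_inv] at this
    have h3 : ‖(1 / 2 : ℂ)‖ = 1 / 2 := by norm_num
    rw [h3]
    nlinarith [norm_nonneg ((ζ - I)⁻¹ + (ζ - -I)⁻¹)]

/-- Over a common denominator the ζ² terms cancel, leaving (1 + ζz)/((ζ - z)(ζ² + 1)). The resulting
quadratic decay matches the weight under which the density is integrable. -/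
lemma norm_potentialKernel_le_of_far {R : ℝ} (hR : 1 ≤ R) {z ζ : ℂ} (hz : ‖z‖ < R)
    (hζ : 2 * R ≤ ‖ζ‖) : ‖potentialKernel z ζ‖ ≤ 16 * R * (1 + ‖ζ‖ ^ 2)⁻¹ := by
  have h1 : ‖ζ‖ / 2 ≤ ‖ζ - z‖ := by
    have := norm_sub_norm_le ζ z
    linarith
  have h2 : ‖ζ‖ ^ 2 / 2 ≤ ‖ζ ^ 2 + 1‖ := by
    have := norm_sub_norm_le (ζ ^ 2) (-1)
    rw [norm_neg, norm_one, norm_pow, sub_neg_eq_add] at this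
    nlinarith
  have hp : 0 < ‖ζ‖ := by linarith
  have hz0 : ζ - z ≠ 0 := norm_pos_iff.1 (by linarith)
  have hz1 : ζ ^ 2 + 1 ≠ 0 := norm_pos_iff.1 (lt_of_lt_of_le (by positivity) h2)
  have e : potentialKernel z ζ = (1 + ζ * z) / ((ζ - z) * (ζ ^ 2 + 1)) := by
    rw [potentialKernel]; field_simp; ring
  have h3 : ‖1 + ζ * z‖ ≤ 2 * R * ‖ζ‖ := by
    have := norm_add_le 1 (ζ * z)
    rw [norm_one, norm_mul] at this
    nlinarith
  rw [e, norm_div, norm_mul]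
  calc ‖1 + ζ * z‖ / (‖ζ - z‖ * ‖ζ ^ 2 + 1‖)
      ≤ (2 * R * ‖ζ‖) / (‖ζ‖ / 2 * (‖ζ‖ ^ 2 / 2)) := by gcongr
    _ = 8 * R / ‖ζ‖ ^ 2 := by field_simp; ring
    _ ≤ 16 * R * (1 + ‖ζ‖ ^ 2)⁻¹ := by
        rw [← div_eq_mul_inv, div_le_div_iff₀ (by positivity) (by positivity)]
        nlinarith

section Potential

variable {q : ℝ} {g : ℂ → ℂ}

lemma PotentialDensity.near_integrable (hg : PotentialDensity q g Set.univ) (R : ℝ) :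
    Integrable ((Metric.ball 0 R).indicator g) := by
  rw [integrable_indicator_iff measurableSet_ball]
  have hm := hg.aesm
  have hw := hg.weighted
  rw [Measure.restrict_univ] at hm
  rw [integrableOn_univ] at hw
  refine Integrable.mono' (hw.integrableOn.const_mul (1 + R ^ 2)) hm.restrict ?_
  filter_upwards [ae_restrict_mem measurableSet_ball] with ζ hζ
  have : ‖ζ‖ < R := by simpa using hζ
  rw [← mul_assoc, ← div_eq_mul_inv]
  refine le_mul_of_one_le_left (norm_nonneg _) ?_
  rw [one_le_div (by positivity)]
  gcongr

lemma PotentialDensity.near_rpow (hg : PotentialDensity q g Set.univ) (hq : 0 < q) (R : ℝ) :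
    Integrable fun ζ => ‖(Metric.ball 0 R).indicator g ζ‖ ^ q := by
  have h := hg.rpow
  rw [integrableOn_univ] at h
  refine (h.indicator (measurableSet_ball (x := (0 : ℂ)) (ε := R))).congr
    (Eventually.of_forall fun ζ => ?_)
  by_cases hζ : ζ ∈ Metric.ball (0 : ℂ) R
  · simp only [Set.indicator_of_mem hζ]
  · simp only [Set.indicator_of_notMem hζ, norm_zero, Real.zero_rpow hq.ne']

lemma potential_eq_split (R : ℝ) (z ζ : ℂ) : g ζ * potentialKernel z ζ =
    (Metric.ball 0 R).indicator g ζ * (1 / (ζ - z))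
      - (Metric.ball 0 R).indicator g ζ * (ζ / (ζ ^ 2 + 1))
      + (Metric.ball 0 R)ᶜ.indicator g ζ * potentialKernel z ζ := by
  by_cases hζ : ζ ∈ Metric.ball (0 : ℂ) R
  · rw [Set.indicator_of_mem hζ, Set.indicator_of_notMem (by simpa using hζ), potentialKernel]
    ring
  · rw [Set.indicator_of_notMem hζ, Set.indicator_of_mem (by simpa using hζ)]
    ring

lemma exists_holderConjugate {q : ℝ} (hq : 2 < q) : ∃ q' : ℝ, q.HolderConjugate q' ∧ q' < 2 := by
  refine ⟨q.conjExponent, Real.HolderConjugate.conjExponent (by linarith), ?_⟩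
  rw [Real.conjExponent, div_lt_iff₀ (by linarith)]
  linarith

lemma PotentialDensity.far_le {R : ℝ} (hR : 1 ≤ R) {z : ℂ} (hz : ‖z‖ < R) (ζ : ℂ) :
    ‖(Metric.ball 0 (2 * R))ᶜ.indicator g ζ * potentialKernel z ζ‖ ≤
      16 * R * ((1 + ‖ζ‖ ^ 2)⁻¹ * ‖g ζ‖) := by
  by_cases hζ : ζ ∈ Metric.ball (0 : ℂ) (2 * R)
  · rw [Set.indicator_of_notMem (by simpa using hζ), zero_mul, norm_zero]
    positivity
  · rw [Set.indicator_of_mem (by simpa using hζ), norm_mul]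
    have := norm_potentialKernel_le_of_far hR hz (ζ := ζ) (by simpa using hζ)
    calc _ ≤ ‖g ζ‖ * (16 * R * (1 + ‖ζ‖ ^ 2)⁻¹) := by gcongr
      _ = _ := by ring

lemma PotentialDensity.far_aesm (hg : PotentialDensity q g Set.univ) (R : ℝ) (z : ℂ) :
    AEStronglyMeasurable (fun ζ => (Metric.ball 0 R)ᶜ.indicator g ζ * potentialKernel z ζ)
      volume := by
  have hm := hg.aesm
  rw [Measure.restrict_univ] at hm
  exact (hm.indicator measurableSet_ball.compl).mul
    (measurable_potentialKernel.comp measurable_prodMk_left).aestronglyMeasurable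

lemma PotentialDensity.near_pieces (hg : PotentialDensity q g Set.univ) (hq : 2 < q) (R : ℝ) :
    ∃ C : ℝ, (∀ z : ℂ, Integrable (fun ζ => (Metric.ball 0 R).indicator g ζ * (1 / (ζ - z))) ∧
      ∫ ζ, ‖(Metric.ball 0 R).indicator g ζ * (1 / (ζ - z))‖ ≤ C) ∧
      Integrable (fun ζ => (Metric.ball 0 R).indicator g ζ * (ζ / (ζ ^ 2 + 1))) := by
  obtain ⟨q', hqq, hq'⟩ := exists_holderConjugate hq
  have h1 := hg.near_integrable R
  obtain ⟨C, hC⟩ := exists_singular_bound hqq one_pos (by linarith) h1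
    (hg.near_rpow (by linarith) R)
  have e : ∀ z ζ : ℂ, ‖(Metric.ball 0 R).indicator g ζ * (1 / (ζ - z))‖ =
      ‖(Metric.ball 0 R).indicator g ζ‖ * ‖ζ - z‖ ^ (-(1 : ℝ)) := fun z ζ => by
    rw [norm_mul, norm_div, norm_one, Real.rpow_neg_one, one_div]
  refine ⟨C, fun z => ⟨?_, ?_⟩, ?_⟩
  · exact Integrable.mono' (hC z).1 (h1.1.mul (Measurable.aestronglyMeasurable (by fun_prop)))
      (Eventually.of_forall fun ζ => (e z ζ).le)
  · simp only [e]
    exact (hC z).2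
  · refine Integrable.mono' ((hC I).1.add (hC (-I)).1)
      (h1.1.mul (Measurable.aestronglyMeasurable (by fun_prop)))
      (Eventually.of_forall fun ζ => ?_)
    rw [norm_mul, Pi.add_apply, ← mul_add]
    gcongr
    exact norm_div_sq_add_one_le ζ

/-- Near part by the uniform singular bound, far part by quadratic decay. Uniformity in z on a disk
is what Fubini against a compactly supported function requires. -/
lemma PotentialDensity.exists_bound (hg : PotentialDensity q g Set.univ) (hq : 2 < q) {R : ℝ}
    (hR : 1 ≤ R) : ∃ C : ℝ, ∀ z : ℂ, ‖z‖ < R → Integrable (fun ζ => g ζ * potentialKernel z ζ) ∧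
      ∫ ζ, ‖g ζ * potentialKernel z ζ‖ ≤ C := by
  obtain ⟨C, hC, hc⟩ := hg.near_pieces hq (2 * R)
  have hw := hg.weighted
  rw [integrableOn_univ] at hw
  have hw' := hw.const_mul (16 * R)
  refine ⟨C + (∫ ζ, ‖(Metric.ball 0 (2 * R)).indicator g ζ * (ζ / (ζ ^ 2 + 1))‖)
    + ∫ ζ, 16 * R * ((1 + ‖ζ‖ ^ 2)⁻¹ * ‖g ζ‖), fun z hz => ?_⟩
  have hfar : Integrable fun ζ => (Metric.ball 0 (2 * R))ᶜ.indicator g ζ * potentialKernel z ζ :=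
    Integrable.mono' hw' (hg.far_aesm _ z)
      (Eventually.of_forall fun ζ => PotentialDensity.far_le hR hz ζ)
  have hint := ((hC z).1.sub hc).add hfar
  have hint' : Integrable (fun ζ => g ζ * potentialKernel z ζ) :=
    hint.congr (Eventually.of_forall fun ζ => (potential_eq_split (2 * R) z ζ).symm)
  refine ⟨hint', ?_⟩
  have i1 : Integrable fun ζ => ‖(Metric.ball 0 (2 * R)).indicator g ζ * (1 / (ζ - z))‖
      + ‖(Metric.ball 0 (2 * R)).indicator g ζ * (ζ / (ζ ^ 2 + 1))‖ :=
    (hC z).1.norm.add hc.norm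
  calc ∫ ζ, ‖g ζ * potentialKernel z ζ‖
      ≤ ∫ ζ, ((‖(Metric.ball 0 (2 * R)).indicator g ζ * (1 / (ζ - z))‖
          + ‖(Metric.ball 0 (2 * R)).indicator g ζ * (ζ / (ζ ^ 2 + 1))‖)
          + 16 * R * ((1 + ‖ζ‖ ^ 2)⁻¹ * ‖g ζ‖)) := by
        refine integral_mono hint'.norm (i1.add hw') fun ζ => ?_
        simp only [potential_eq_split (g := g) (2 * R) z ζ]
        refine (norm_add_le _ _).trans ?_
        exact add_le_add (norm_sub_le _ _) (PotentialDensity.far_le hR hz ζ)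
    _ = (∫ ζ, ‖(Metric.ball 0 (2 * R)).indicator g ζ * (1 / (ζ - z))‖)
          + (∫ ζ, ‖(Metric.ball 0 (2 * R)).indicator g ζ * (ζ / (ζ ^ 2 + 1))‖)
          + ∫ ζ, 16 * R * ((1 + ‖ζ‖ ^ 2)⁻¹ * ‖g ζ‖) := by
        rw [integral_add i1 hw', integral_add (hC z).1.norm hc.norm]
    _ ≤ _ := by
        gcongr
        exact (hC z).2

lemma PotentialDensity.integrable (hg : PotentialDensity q g Set.univ) (hq : 2 < q) (z : ℂ) :
    Integrable fun ζ => g ζ * potentialKernel z ζ := by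
  obtain ⟨C, hC⟩ := hg.exists_bound hq (R := ‖z‖ + 1) (by linarith [norm_nonneg z])
  exact (hC z (by linarith)).1

/-- For z in the disk of radius R, cut the density at radius 2R: the near part is a Cauchy transform
plus a constant, and the far part has no singularity in z and is dominated by the weighted density.
-/
lemma PotentialDensity.continuous_potential (hg : PotentialDensity q g Set.univ) (hq : 2 < q) :
    Continuous (potential g) := by
  obtain ⟨q', hqq, hq'⟩ := exists_holderConjugate hq
  rw [continuous_iff_continuousAt]
  intro z₀
  set R := ‖z₀‖ + 1 with hRdef
  have hR : 1 ≤ R := by linarith [norm_nonneg z₀]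
  have hw := hg.weighted
  rw [integrableOn_univ] at hw
  have hw' := hw.const_mul (16 * R)
  obtain ⟨C, hC, hc⟩ := hg.near_pieces hq (2 * R)
  have hcont : ContinuousOn (fun z => (∫ ζ, (Metric.ball 0 (2 * R)).indicator g ζ * (1 / (ζ - z)))
      - (∫ ζ, (Metric.ball 0 (2 * R)).indicator g ζ * (ζ / (ζ ^ 2 + 1)))
      + ∫ ζ, (Metric.ball 0 (2 * R))ᶜ.indicator g ζ * potentialKernel z ζ) (Metric.ball 0 R) := by
    refine ((continuous_cauchyTransform hqq hq' (hg.near_integrable _)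
      (hg.near_rpow (by linarith) _)).continuousOn.sub continuousOn_const).add ?_
    refine continuousOn_of_dominated (fun z _ => hg.far_aesm _ z)
      (fun z hz => Eventually.of_forall fun ζ => PotentialDensity.far_le hR (by simpa using hz) ζ)
      hw' (Eventually.of_forall fun ζ => ?_)
    by_cases hζ : ζ ∈ Metric.ball (0 : ℂ) (2 * R)
    · simp only [Set.indicator_of_notMem (show ζ ∉ (Metric.ball (0 : ℂ) (2 * R))ᶜ by simpa using hζ),
        zero_mul]
      exact continuousOn_const
    · unfold potentialKernel
      refine continuousOn_const.mul ((continuousOn_const.div (by fun_prop) fun z hz h => ?_).sub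
        continuousOn_const)
      have h1 : ‖z‖ < R := by simpa using hz
      have h2 : 2 * R ≤ ‖ζ‖ := by simpa using hζ
      rw [sub_eq_zero.1 h] at h2
      linarith
  have hnhds : Metric.ball (0 : ℂ) R ∈ 𝓝 z₀ :=
    Metric.isOpen_ball.mem_nhds (by simp [hRdef])
  refine (hcont.continuousAt hnhds).congr ?_
  filter_upwards [hnhds] with z hz
  have hfar : Integrable fun ζ => (Metric.ball 0 (2 * R))ᶜ.indicator g ζ * potentialKernel z ζ :=
    Integrable.mono' hw' (hg.far_aesm _ z)
      (Eventually.of_forall fun ζ => PotentialDensity.far_le hR (by simpa using hz) ζ)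
  have hnear : Integrable fun ζ => (Metric.ball 0 (2 * R)).indicator g ζ * (1 / (ζ - z))
      - (Metric.ball 0 (2 * R)).indicator g ζ * (ζ / (ζ ^ 2 + 1)) := (hC z).1.sub hc
  rw [potential, ← integral_sub (hC z).1 hc, ← integral_add hnear hfar]
  exact integral_congr_ae (Eventually.of_forall fun ζ => (potential_eq_split (2 * R) z ζ).symm)

end Potential

/-! ### Schwarz reflection and the values of 𝒯 on ℝ and at i -/

lemma measurePreserving_conj : MeasurePreserving (starRingEnd ℂ) (volume : Measure ℂ) volume :=
  Complex.conjLIE.measurePreserving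

lemma measurableEmbedding_conj : MeasurableEmbedding (starRingEnd ℂ) :=
  Complex.conjLIE.toHomeomorph.measurableEmbedding

lemma integral_comp_conj (k : ℂ → ℂ) : ∫ ζ, k ((starRingEnd ℂ) ζ) = ∫ ζ, k ζ :=
  measurePreserving_conj.integral_comp measurableEmbedding_conj k

lemma integrable_comp_conj {F : Type*} [NormedAddCommGroup F] {k : ℂ → F} (hk : Integrable k) :
    Integrable fun ζ => k ((starRingEnd ℂ) ζ) :=
  (measurePreserving_conj.integrable_comp_emb measurableEmbedding_conj).2 hk

/-- The Schwarz reflection `conj (g (conj ζ))` of `g`. -/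
noncomputable def reflect (g : ℂ → ℂ) (ζ : ℂ) : ℂ := (starRingEnd ℂ) (g ((starRingEnd ℂ) ζ))

lemma PotentialDensity.indicator {q : ℝ} (hq : 0 < q) {f : ℂ → ℂ}
    (hf : PotentialDensity q f upperPlane) :
    PotentialDensity q (upperPlane.indicator f) Set.univ where
  aesm := by
    rw [Measure.restrict_univ]
    exact (aestronglyMeasurable_indicator_iff measurableSet_upperPlane).2 hf.aesm
  rpow := by
    rw [integrableOn_univ]
    refine ((integrable_indicator_iff measurableSet_upperPlane).2 hf.rpow).congr
      (Eventually.of_forall fun ζ => ?_)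
    by_cases hζ : ζ ∈ upperPlane
    · simp only [Set.indicator_of_mem hζ]
    · simp only [Set.indicator_of_notMem hζ, norm_zero, Real.zero_rpow hq.ne']
  weighted := by
    rw [integrableOn_univ]
    refine ((integrable_indicator_iff measurableSet_upperPlane).2 hf.weighted).congr
      (Eventually.of_forall fun ζ => ?_)
    by_cases hζ : ζ ∈ upperPlane
    · simp only [Set.indicator_of_mem hζ]
    · simp only [Set.indicator_of_notMem hζ, norm_zero, mul_zero]

lemma PotentialDensity.reflect {q : ℝ} {g : ℂ → ℂ} (hg : PotentialDensity q g Set.univ) :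
    PotentialDensity q (reflect g) Set.univ where
  aesm := by
    have := hg.aesm
    rw [Measure.restrict_univ] at this ⊢
    exact Complex.continuous_conj.comp_aestronglyMeasurable
      (this.comp_measurePreserving measurePreserving_conj)
  rpow := by
    have := hg.rpow
    rw [integrableOn_univ] at this ⊢
    simpa [SchwarzUHP.reflect] using integrable_comp_conj this
  weighted := by
    have := hg.weighted
    rw [integrableOn_univ] at this ⊢
    simpa [SchwarzUHP.reflect] using integrable_comp_conj this

lemma potentialKernel_conj (z ζ : ℂ) : potentialKernel z ((starRingEnd ℂ) ζ) =
    (starRingEnd ℂ) (potentialKernel ((starRingEnd ℂ) z) ζ) := by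
  simp [potentialKernel]

lemma potential_reflect (g : ℂ → ℂ) (z : ℂ) :
    potential (reflect g) z = (starRingEnd ℂ) (potential g ((starRingEnd ℂ) z)) := by
  rw [potential, ← integral_comp_conj, potential, ← integral_conj]
  simp [reflect, potentialKernel_conj]

/-- At z = i the compensated kernel is ½(1/(ζ - i) - 1/(ζ + i)), which changes sign under i ↦ -i. -/
lemma potential_neg_I (g : ℂ → ℂ) : potential g (-I) = -potential g I := by
  rw [potential, potential, ← integral_neg]
  refine integral_congr_ae ?_
  filter_upwards [compl_mem_ae_iff.2 (measure_singleton I),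
    compl_mem_ae_iff.2 (measure_singleton (-I))] with ζ h1 h2
  have h1' : ζ - I ≠ 0 := sub_ne_zero.2 h1
  have h2' : ζ - -I ≠ 0 := sub_ne_zero.2 h2
  have hf : ζ ^ 2 + 1 = (ζ - I) * (ζ - -I) := by linear_combination I_sq
  have : potentialKernel (-I) ζ = -potentialKernel I ζ := by
    rw [potentialKernel, potentialKernel, hf]
    field_simp
    ring
  rw [this]
  ring

/-- The conjugated half of the integrand is the integrand of the reflected density, evaluated at the
conjugate of ζ; the substitution ζ ↦ conj ζ then gives a difference of two potentials. -/
lemma indicator_schwarzKernel (f : ℂ → ℂ) (z : ℂ) :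
    upperPlane.indicator (schwarzKernel f z) = fun ζ =>
      upperPlane.indicator f ζ * potentialKernel z ζ -
      reflect (upperPlane.indicator f) ((starRingEnd ℂ) ζ) *
        potentialKernel z ((starRingEnd ℂ) ζ) := by
  funext ζ
  simp only [reflect, Complex.conj_conj]
  by_cases hζ : ζ ∈ upperPlane
  · simp only [Set.indicator_of_mem hζ]
    rfl
  · simp [Set.indicator_of_notMem hζ]

section

variable {q : ℝ} {f : ℂ → ℂ}

lemma integrableOn_schwarzKernel (hq : 2 < q) (hf : PotentialDensity q f upperPlane) (z : ℂ) :
    IntegrableOn (schwarzKernel f z) upperPlane := by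
  have hF := hf.indicator (by linarith)
  rw [← integrable_indicator_iff measurableSet_upperPlane, indicator_schwarzKernel]
  exact (hF.integrable hq z).sub (integrable_comp_conj (hF.reflect.integrable hq z))

lemma schwarzT_eq (hq : 2 < q) (hf : PotentialDensity q f upperPlane) (z : ℂ) :
    schwarzT f z = -(1 / (Real.pi : ℂ)) * (potential (upperPlane.indicator f) z -
      potential (reflect (upperPlane.indicator f)) z) := by
  have hF := hf.indicator (by linarith)
  rw [schwarzT, ← integral_indicator measurableSet_upperPlane, indicator_schwarzKernel,
    integral_sub (hF.integrable hq z) (integrable_comp_conj (hF.reflect.integrable hq z)),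
    integral_comp_conj fun ζ => reflect (upperPlane.indicator f) ζ * potentialKernel z ζ]
  rfl

lemma continuous_schwarzT (hq : 2 < q) (hf : PotentialDensity q f upperPlane) :
    Continuous (schwarzT f) := by
  have hF := hf.indicator (by linarith)
  rw [funext (schwarzT_eq hq hf)]
  exact continuous_const.mul ((hF.continuous_potential hq).sub
    (hF.reflect.continuous_potential hq))

/-- At a real point the two potentials are complex conjugates, so their difference is imaginary. -/
lemma schwarzT_ofReal_re (hq : 2 < q) (hf : PotentialDensity q f upperPlane) (x : ℝ) :
    (schwarzT f x).re = 0 := by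
  rw [schwarzT_eq hq hf, potential_reflect, Complex.conj_ofReal, Complex.sub_conj,
    show (1 / (Real.pi : ℂ)) = ((1 / Real.pi : ℝ) : ℂ) by push_cast; rfl]
  simp

/-- Reflection moves i to -i, where the potential changes sign; the difference becomes a number plus
its conjugate. -/
lemma schwarzT_I_im (hq : 2 < q) (hf : PotentialDensity q f upperPlane) :
    (schwarzT f I).im = 0 := by
  rw [schwarzT_eq hq hf, potential_reflect, Complex.conj_I, potential_neg_I, map_neg,
    sub_neg_eq_add, Complex.add_conj,
    show (1 / (Real.pi : ℂ)) = ((1 / Real.pi : ℝ) : ℂ) by push_cast; rfl]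
  simp

end

/-! ### The Cauchy–Pompeiu formula and the weak ∂/∂z̄ equation -/

lemma continuous_dbar {φ : ℂ → ℂ} (hφ : ContDiff ℝ (⊤ : ℕ∞) φ) : Continuous (dbar φ) := by
  have h := hφ.continuous_fderiv (by simp)
  unfold dbar
  fun_prop

lemma hasCompactSupport_dbar {φ : ℂ → ℂ} (hφ : HasCompactSupport φ) :
    HasCompactSupport (dbar φ) := by
  refine (hφ.fderiv (𝕜 := ℝ)).mono fun z hz => ?_
  contrapose! hz
  simp only [Function.mem_support, not_not] at hz ⊢
  simp [dbar, hz]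

lemma integral_dbar_eq_zero {φ : ℂ → ℂ} (hφ : ContDiff ℝ 1 φ)
    (hc : HasCompactSupport φ) : ∫ z, dbar φ z = 0 := by
  have hf := hφ.continuous_fderiv (by simp)
  have hi : ∀ v : ℂ, Integrable fun z => fderiv ℝ φ z v := fun v =>
    Continuous.integrable_of_hasCompactSupport (by fun_prop) (hc.fderiv_apply (𝕜 := ℝ) v)
  have h0 : ∀ v : ℂ, ∫ z, fderiv ℝ φ z v = 0 := fun v => by
    have := integral_mul_fderiv_eq_neg_fderiv_mul_of_integrable
      (μ := (volume : Measure ℂ)) (f := fun _ : ℂ => (1 : ℂ)) (g := φ) (v := v)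
      (by simp) (by simpa using hi v)
      (by simpa using hφ.continuous.integrable_of_hasCompactSupport hc)
      (fun _ _ => by fun_prop) (fun z _ => hφ.differentiable (by simp) z)
    simpa using this
  unfold dbar
  rw [integral_const_mul, integral_add (hi 1) ((hi I).const_mul I), integral_const_mul, h0, h0]
  simp

/-- The circle parametrization direction `e^{iθ} = cos θ + i sin θ`. -/
noncomputable def dir (θ : ℝ) : ℂ := Real.cos θ + Real.sin θ * I

lemma hasDerivAt_dir (θ : ℝ) : HasDerivAt dir (I * dir θ) θ := by
  have h1 : HasDerivAt (fun θ : ℝ => ((Real.cos θ : ℝ) : ℂ)) ((-Real.sin θ : ℝ) : ℂ) θ :=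
    (Real.hasDerivAt_cos θ).ofReal_comp
  have h2 : HasDerivAt (fun θ : ℝ => ((Real.sin θ : ℝ) : ℂ)) ((Real.cos θ : ℝ) : ℂ) θ :=
    (Real.hasDerivAt_sin θ).ofReal_comp
  refine (h1.add (h2.mul_const I)).congr_deriv ?_
  rw [dir, ofReal_neg]
  linear_combination (-(Real.sin θ : ℂ)) * I_sq

@[fun_prop]
lemma continuous_dir : Continuous dir := by unfold dir; fun_prop

lemma norm_dir (θ : ℝ) : ‖dir θ‖ = 1 := by
  rw [dir, ofReal_cos, ofReal_sin, ← exp_mul_I, norm_exp_ofReal_mul_I]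

/-- This is ∂/∂z̄ = (e^{iθ}/2)(∂_r + (i/r)∂_θ): the derivative along i e^{iθ} is r⁻¹∂_θ, and the
Jacobian r together with 1/u removes the prefactor. -/
lemma dbar_polar (ψ : ℂ → ℂ) {r : ℝ} (hr : r ≠ 0) (θ : ℝ) :
    (r : ℝ) • (dbar ψ (r * dir θ) * (1 / (r * dir θ))) =
      (1 / 2 : ℂ) * (fderiv ℝ ψ (r * dir θ) (dir θ) + I * fderiv ℝ ψ (r * dir θ) (I * dir θ)) := by
  have hd : dir θ ≠ 0 := norm_pos_iff.1 (by rw [norm_dir]; exact one_pos)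
  have hrc : (r : ℂ) ≠ 0 := by exact_mod_cast hr
  set D := fderiv ℝ ψ (r * dir θ) with hD
  have e1 : D (dir θ) = Real.cos θ * D 1 + Real.sin θ * D I := by
    have : dir θ = (Real.cos θ) • (1 : ℂ) + (Real.sin θ) • I := by simp [dir]
    rw [this, map_add, map_smul, map_smul]
    simp
  have e2 : D (I * dir θ) = Real.cos θ * D I - Real.sin θ * D 1 := by
    have : I * dir θ = (Real.cos θ) • I - (Real.sin θ) • (1 : ℂ) := by
      simp only [dir, Complex.real_smul]
      linear_combination (Real.sin θ : ℂ) * I_sq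
    rw [this, map_sub, map_smul, map_smul]
    simp
  have hcs : (Real.cos θ : ℂ) ^ 2 + (Real.sin θ : ℂ) ^ 2 = 1 := by
    exact_mod_cast Real.cos_sq_add_sin_sq θ
  have e3 : D (dir θ) + I * D (I * dir θ) = (Real.cos θ - Real.sin θ * I) * (D 1 + I * D I) := by
    rw [e1, e2]
    linear_combination (Real.sin θ : ℂ) * D I * I_sq
  have e4 : (Real.cos θ - Real.sin θ * I) * dir θ = 1 := by
    rw [dir]
    linear_combination hcs - (Real.sin θ : ℂ) ^ 2 * I_sq
  rw [e3, dbar, ← hD, Complex.real_smul]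
  field_simp
  linear_combination (-1 : ℂ) * (D 1 + I * D I) * e4

/-- The Cauchy–Pompeiu formula for compactly supported functions. -/
lemma integral_dbar_mul_inv {ψ : ℂ → ℂ} (hψ : ContDiff ℝ 1 ψ) (hc : HasCompactSupport ψ) :
    ∫ u, dbar ψ u * (1 / u) = -(Real.pi : ℂ) * ψ 0 := by
  have hf := hψ.continuous_fderiv (by simp)
  have hdiff : ∀ u, HasFDerivAt ψ (fderiv ℝ ψ u) u := fun u =>
    (hψ.differentiable (by simp) u).hasFDerivAt
  obtain ⟨R, hR⟩ : ∃ R : ℝ, ∀ u : ℂ, R < ‖u‖ → u ∉ tsupport ψ := by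
    obtain ⟨R, hR⟩ := hc.isCompact.isBounded.exists_norm_le
    exact ⟨R, fun u hu h => not_lt.2 (hR u h) hu⟩
  -- The bound R may be negative when the support is empty, hence |R|.
  have hR0 : ∀ r θ : ℝ, |R| < r → fderiv ℝ ψ (r * dir θ) = 0 := by
    intro r θ hr
    have hr0 : 0 < r := (abs_nonneg R).trans_lt hr
    refine image_eq_zero_of_notMem_tsupport fun h => ?_
    refine hR _ ?_ (tsupport_fderiv_subset ℝ h)
    rw [norm_mul, norm_dir, mul_one, Complex.norm_real, Real.norm_of_nonneg hr0.le]
    exact (le_abs_self R).trans_lt hr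
  let A : ℝ × ℝ → ℂ := fun p => fderiv ℝ ψ (p.1 * dir p.2) (dir p.2)
  let B : ℝ × ℝ → ℂ := fun p => I * fderiv ℝ ψ (p.1 * dir p.2) (I * dir p.2)
  have hA : Continuous A := by fun_prop
  have hB : Continuous B := by fun_prop
  have hint : ∀ G : ℝ × ℝ → ℂ, Continuous G → (∀ r θ : ℝ, |R| < r → G (r, θ) = 0) →
      IntegrableOn G (Set.Ioi 0 ×ˢ Set.Ioo (-Real.pi) Real.pi) := by
    intro G hG h0
    have h1 : IntegrableOn G (Set.Icc 0 |R| ×ˢ Set.Icc (-Real.pi) Real.pi) :=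
      hG.continuousOn.integrableOn_compact (isCompact_Icc.prod isCompact_Icc)
    refine h1.of_forall_sdiff_eq_zero (measurableSet_Ioi.prod measurableSet_Ioo) ?_
    rintro ⟨r, θ⟩ ⟨⟨hr, hθ⟩, hn⟩
    refine h0 r θ (not_le.1 fun h => hn ⟨⟨le_of_lt hr, h⟩, ⟨hθ.1.le, hθ.2.le⟩⟩)
  have iA := hint A hA fun r θ h => by simp [A, hR0 r θ h]
  have iB := hint B hB fun r θ h => by simp [B, hR0 r θ h]
  -- Integrating in r first, the radial derivative contributes -ψ(0) on every ray.
  have vA : ∫ p in Set.Ioi (0 : ℝ) ×ˢ Set.Ioo (-Real.pi) Real.pi, A p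
      = -(2 * Real.pi : ℂ) * ψ 0 := by
    rw [Measure.volume_eq_prod, ← setIntegral_prod_swap,
      setIntegral_prod (fun p => A p.swap) (by
        have := iA
        rw [Measure.volume_eq_prod, IntegrableOn, ← Measure.prod_restrict] at this
        rw [IntegrableOn, ← Measure.prod_restrict]
        exact this.swap)]
    have : ∀ θ : ℝ, ∫ r in Set.Ioi (0 : ℝ), A (r, θ) = -ψ 0 := by
      intro θ
      have hd : ∀ r ∈ Set.Ici (0 : ℝ), HasDerivAt (fun r : ℝ => ψ (r * dir θ)) (A (r, θ)) r := by
        intro r _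
        have h1 : HasDerivAt (fun r : ℝ => (r : ℂ) * dir θ) (1 * dir θ) r :=
          (hasDerivAt_id r).ofReal_comp.mul_const (dir θ)
        rw [one_mul] at h1
        exact (hdiff _).comp_hasDerivAt r h1
      have hi : IntegrableOn (fun r : ℝ => A (r, θ)) (Set.Ioi 0) := by
        have h1 : IntegrableOn (fun r : ℝ => A (r, θ)) (Set.Icc 0 |R|) :=
          (show Continuous fun r : ℝ => A (r, θ) by fun_prop).continuousOn.integrableOn_compact
            isCompact_Icc
        refine h1.of_forall_sdiff_eq_zero measurableSet_Ioi ?_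
        rintro r ⟨hr, hn⟩
        simp [A, hR0 r θ (not_le.1 fun h => hn ⟨le_of_lt hr, h⟩)]
      have ht : Tendsto (fun r : ℝ => ψ (r * dir θ)) atTop (𝓝 0) := by
        refine tendsto_const_nhds.congr' ?_
        filter_upwards [eventually_gt_atTop |R|] with r hr
        have hr0 : 0 < r := (abs_nonneg R).trans_lt hr
        refine (image_eq_zero_of_notMem_tsupport (hR _ ?_)).symm
        rw [norm_mul, norm_dir, mul_one, Complex.norm_real, Real.norm_of_nonneg hr0.le]
        exact (le_abs_self R).trans_lt hr
      rw [integral_Ioi_of_hasDerivAt_of_tendsto' hd hi ht]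
      simp
    simp only [Prod.swap_prod_mk, this]
    rw [setIntegral_const, Real.volume_real_Ioo_of_le (by linarith [Real.pi_pos]),
      Complex.real_smul]
    push_cast
    ring
  -- On each circle B is the θ-derivative of a 2π-periodic function.
  have vB : ∫ p in Set.Ioi (0 : ℝ) ×ˢ Set.Ioo (-Real.pi) Real.pi, B p = 0 := by
    rw [Measure.volume_eq_prod, setIntegral_prod B (by rwa [← Measure.volume_eq_prod])]
    refine setIntegral_eq_zero_of_forall_eq_zero fun r hr => ?_
    have hr0 : (r : ℂ) ≠ 0 := by exact_mod_cast (ne_of_gt hr)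
    have hd : ∀ θ : ℝ, HasDerivAt (fun θ : ℝ => I * (r : ℂ)⁻¹ * ψ (r * dir θ)) (B (r, θ)) θ := by
      intro θ
      have h1 := (hdiff (r * dir θ)).comp_hasDerivAt θ ((hasDerivAt_dir θ).const_mul (r : ℂ))
      refine (h1.const_mul (I * (r : ℂ)⁻¹)).congr_deriv ?_
      rw [← Complex.real_smul (x := r) (z := I * dir θ), map_smul, Complex.real_smul]
      simp only [B]
      field_simp
    have hπ : -Real.pi ≤ Real.pi := by linarith [Real.pi_pos]
    rw [← integral_Ioc_eq_integral_Ioo, ← intervalIntegral.integral_of_le hπ,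
      intervalIntegral.integral_eq_sub_of_hasDerivAt (fun θ _ => hd θ)
        ((show Continuous fun θ : ℝ => B (r, θ) by fun_prop).intervalIntegrable _ _)]
    simp [dir]
  rw [← Complex.integral_comp_polarCoord_symm]
  calc _ = ∫ p in Set.Ioi (0 : ℝ) ×ˢ Set.Ioo (-Real.pi) Real.pi, (1 / 2 : ℂ) * (A p + B p) := by
        refine setIntegral_congr_fun (measurableSet_Ioi.prod measurableSet_Ioo) fun p hp => ?_
        have := dbar_polar ψ (ne_of_gt hp.1) p.2
        rw [Complex.polarCoord_symm_apply]
        exact this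
    _ = -(Real.pi : ℂ) * ψ 0 := by
        rw [integral_const_mul, integral_add iA iB, vA, vB]
        ring

lemma integral_dbar_mul_cauchyKernel {φ : ℂ → ℂ} (hφ : ContDiff ℝ (⊤ : ℕ∞) φ)
    (hc : HasCompactSupport φ) (ζ : ℂ) :
    ∫ z, dbar φ z * (1 / (ζ - z)) = (Real.pi : ℂ) * φ ζ := by
  have h1 : ContDiff ℝ 1 fun u => φ (u + ζ) :=
    (hφ.of_le (by simp)).comp (contDiff_id.add contDiff_const)
  have h2 : HasCompactSupport fun u => φ (u + ζ) :=
    hc.comp_homeomorph (Homeomorph.addRight ζ)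
  have h3 := integral_dbar_mul_inv h1 h2
  rw [← integral_add_right_eq_self _ ζ]
  have h4 : ∀ u, dbar φ (u + ζ) * (1 / (ζ - (u + ζ))) =
      -(dbar (fun u => φ (u + ζ)) u * (1 / u)) := by
    intro u
    have : dbar (fun u => φ (u + ζ)) u = dbar φ (u + ζ) := by
      simp only [dbar, fderiv_comp_add_right]
    rw [this, show ζ - (u + ζ) = -u by ring, div_neg, mul_neg]
  simp only [h4]
  rw [integral_neg, h3]
  simp

lemma integrable_dbar_mul_cauchyKernel {φ : ℂ → ℂ} (hφ : ContDiff ℝ (⊤ : ℕ∞) φ)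
    (hc : HasCompactSupport φ) (ζ : ℂ) : Integrable fun z => dbar φ z * (1 / (ζ - z)) := by
  have hcont := continuous_dbar hφ
  have hcs := hasCompactSupport_dbar hc
  -- Any exponent above 2 serves, since the density is continuous with compact support.
  obtain ⟨q', hqq, hq'⟩ := exists_holderConjugate (q := 3) (by norm_num)
  have i1 := hcont.integrable_of_hasCompactSupport hcs (μ := volume)
  have i2 : Integrable fun ζ => ‖dbar φ ζ‖ ^ (3 : ℝ) := by
    refine Continuous.integrable_of_hasCompactSupport (by fun_prop (disch := norm_num)) ?_
    exact hcs.comp_left (g := fun w : ℂ => ‖w‖ ^ (3 : ℝ)) (by simp)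
  obtain ⟨C, hC⟩ := exists_singular_bound hqq one_pos (by linarith) i1 i2
  refine Integrable.mono' (hC ζ).1 (i1.1.mul (Measurable.aestronglyMeasurable (by fun_prop)))
    (Eventually.of_forall fun z => ?_)
  rw [norm_mul, norm_div, norm_one, Real.rpow_neg_one, one_div, norm_sub_rev]

lemma integrable_potential_prod {q : ℝ} {g : ℂ → ℂ} (hg : PotentialDensity q g Set.univ)
    (hq : 2 < q) {k : ℂ → ℂ} (hk : Continuous k) (hc : HasCompactSupport k) :
    Integrable (fun p : ℂ × ℂ => g p.2 * potentialKernel p.1 p.2 * k p.1)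
      (volume.prod volume) := by
  have hm := hg.aesm
  rw [Measure.restrict_univ] at hm
  have hmeas : AEStronglyMeasurable (fun p : ℂ × ℂ => g p.2 * potentialKernel p.1 p.2 * k p.1)
      (volume.prod volume) :=
    (hm.comp_snd.mul measurable_potentialKernel.aestronglyMeasurable).mul
      (hk.comp continuous_fst).aestronglyMeasurable
  obtain ⟨R, hR1, hR⟩ : ∃ R : ℝ, 1 ≤ R ∧ ∀ z, k z ≠ 0 → ‖z‖ < R := by
    obtain ⟨R, hR⟩ := hc.isCompact.isBounded.exists_norm_le
    exact ⟨max R 0 + 1, by linarith [le_max_right R 0], fun z hz =>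
      (hR z (subset_tsupport _ hz)).trans_lt (by linarith [le_max_left R 0])⟩
  obtain ⟨C, hC⟩ := hg.exists_bound hq hR1
  rw [integrable_prod_iff hmeas]
  refine ⟨Eventually.of_forall fun z => (hg.integrable hq z).mul_const (k z), ?_⟩
  refine Integrable.mono' ((hk.integrable_of_hasCompactSupport hc).norm.const_mul C)
    hmeas.norm.integral_prod_right' (Eventually.of_forall fun z => ?_)
  rw [Real.norm_of_nonneg (integral_nonneg fun _ => norm_nonneg _)]
  simp only [norm_mul (_ * _) (k z)]
  rw [integral_mul_const]
  by_cases hz : k z = 0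
  · simp [hz]
  · exact mul_le_mul_of_nonneg_right (hC z (hR z hz)).2 (norm_nonneg _)

/-- After Fubini the Cauchy kernel reproduces πφ, while the compensating term is constant in z and
is killed by ∫ ∂φ/∂z̄ = 0. -/
lemma integral_potential_mul_dbar {q : ℝ} {g : ℂ → ℂ} (hg : PotentialDensity q g Set.univ)
    (hq : 2 < q) {φ : ℂ → ℂ} (hφ : ContDiff ℝ (⊤ : ℕ∞) φ) (hc : HasCompactSupport φ) :
    ∫ z, potential g z * dbar φ z = (Real.pi : ℂ) * ∫ ζ, g ζ * φ ζ := by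
  have hcont := continuous_dbar hφ
  have hcs := hasCompactSupport_dbar hc
  have i1 := hcont.integrable_of_hasCompactSupport hcs (μ := volume)
  calc ∫ z, potential g z * dbar φ z
      = ∫ z, ∫ ζ, g ζ * potentialKernel z ζ * dbar φ z := by
        simp only [potential, integral_mul_const]
    _ = ∫ ζ, ∫ z, g ζ * potentialKernel z ζ * dbar φ z :=
        integral_integral_swap (integrable_potential_prod hg hq hcont hcs)
    _ = ∫ ζ, (Real.pi : ℂ) * (g ζ * φ ζ) := by
        refine integral_congr_ae (Eventually.of_forall fun ζ => ?_)
        have e : ∀ z, g ζ * potentialKernel z ζ * dbar φ z =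
            g ζ * (dbar φ z * (1 / (ζ - z)) - dbar φ z * (ζ / (ζ ^ 2 + 1))) := fun z => by
          rw [potentialKernel]; ring
        simp only [e]
        rw [integral_const_mul, integral_sub (integrable_dbar_mul_cauchyKernel hφ hc ζ)
          (i1.mul_const _), integral_mul_const, integral_dbar_mul_cauchyKernel hφ hc,
          integral_dbar_eq_zero (hφ.of_le (by simp)) hc]
        ring
    _ = _ := integral_const_mul _ _

lemma dbar_eq_zero_of_notMem_tsupport {φ : ℂ → ℂ} {z : ℂ} (hz : z ∉ tsupport φ) :
    dbar φ z = 0 := by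
  have : fderiv ℝ φ z = 0 :=
    image_eq_zero_of_notMem_tsupport fun h => hz (tsupport_fderiv_subset ℝ h)
  simp [dbar, this]

lemma setIntegral_upperPlane_eq {φ k : ℂ → ℂ} (hs : tsupport φ ⊆ upperPlane)
    (hk : ∀ z, z ∉ tsupport φ → k z = 0) : ∫ z in upperPlane, k z = ∫ z, k z :=
  setIntegral_eq_integral_of_forall_compl_eq_zero fun z hz => hk z fun h => hz (hs h)

lemma integral_schwarzT_mul_dbar {q : ℝ} {f : ℂ → ℂ} (hq : 2 < q)
    (hf : PotentialDensity q f upperPlane) {φ : ℂ → ℂ} (hφ : ContDiff ℝ (⊤ : ℕ∞) φ)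
    (hc : HasCompactSupport φ) (hs : tsupport φ ⊆ upperPlane) :
    ∫ z in upperPlane, schwarzT f z * dbar φ z = -∫ z in upperPlane, f z * φ z := by
  have hF := hf.indicator (by linarith)
  have hcont := continuous_dbar hφ
  have hcs := hasCompactSupport_dbar hc
  have hi : ∀ g : ℂ → ℂ, PotentialDensity q g Set.univ →
      Integrable fun z => potential g z * dbar φ z := fun g hg =>
    ((hg.continuous_potential hq).mul hcont).integrable_of_hasCompactSupport hcs.mul_left
  rw [setIntegral_upperPlane_eq hs fun z hz => by rw [dbar_eq_zero_of_notMem_tsupport hz, mul_zero]]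
  have e : ∀ z, schwarzT f z * dbar φ z = -(1 / (Real.pi : ℂ)) *
      (potential (upperPlane.indicator f) z * dbar φ z -
        potential (reflect (upperPlane.indicator f)) z * dbar φ z) := fun z => by
    rw [schwarzT_eq hq hf]; ring
  simp only [e]
  rw [integral_const_mul, integral_sub (hi _ hF) (hi _ hF.reflect),
    integral_potential_mul_dbar hF hq hφ hc, integral_potential_mul_dbar hF.reflect hq hφ hc]
  -- The reflected density vanishes on ℂ₊, which contains the support of φ.
  have h0 : ∀ ζ, reflect (upperPlane.indicator f) ζ * φ ζ = 0 := by
    intro ζ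
    by_cases hζ : ζ ∈ upperPlane
    · have : (starRingEnd ℂ) ζ ∉ upperPlane := by
        simp only [upperPlane, Set.mem_ofPred_eq, Complex.conj_im] at hζ ⊢
        linarith
      rw [reflect, Set.indicator_of_notMem this, map_zero, zero_mul]
    · rw [image_eq_zero_of_notMem_tsupport (f := φ) fun h => hζ (hs h), mul_zero]
  have h1 : ∫ ζ, upperPlane.indicator f ζ * φ ζ = ∫ z in upperPlane, f z * φ z := by
    rw [← integral_indicator measurableSet_upperPlane]
    refine integral_congr_ae (Eventually.of_forall fun ζ => ?_)
    by_cases hζ : ζ ∈ upperPlane <;> simp [hζ]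
  have hπ : (Real.pi : ℂ) ≠ 0 := by exact_mod_cast Real.pi_ne_zero
  simp only [h0]
  rw [h1, integral_zero]
  field_simp
  ring

/-- The product hφ, zero off the support of φ, is C¹ on the plane, and its ∂/∂z̄ derivative is h
∂φ/∂z̄ by the Cauchy–Riemann equations. -/
lemma integral_holomorphic_mul_dbar {h φ : ℂ → ℂ} (hh : DifferentiableOn ℂ h upperPlane)
    (hφ : ContDiff ℝ (⊤ : ℕ∞) φ) (hc : HasCompactSupport φ) (hs : tsupport φ ⊆ upperPlane) :
    ∫ z in upperPlane, h z * dbar φ z = 0 := by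
  have hsub : tsupport (fun z => h z * φ z) ⊆ tsupport φ := tsupport_mul_subset_right
  have hcd : ContDiff ℝ 1 fun z => h z * φ z := by
    refine contDiff_iff_contDiffAt.2 fun z => ?_
    by_cases hz : z ∈ tsupport φ
    swap
    · refine (contDiffAt_const (c := (0 : ℂ))).congr_of_eventuallyEq ?_
      filter_upwards [(isClosed_tsupport φ).isOpen_compl.mem_nhds hz] with w hw
      rw [image_eq_zero_of_notMem_tsupport hw, mul_zero]
    have hz' := hs hz
    exact (((hh.analyticAt (isOpen_upperPlane.mem_nhds hz')).contDiffAt).restrict_scalars ℝ).mul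
      (hφ.of_le (by simp)).contDiffAt
  rw [setIntegral_upperPlane_eq hs fun z hz => by rw [dbar_eq_zero_of_notMem_tsupport hz, mul_zero],
    ← integral_dbar_eq_zero hcd hc.mul_left]
  refine integral_congr_ae (Eventually.of_forall fun z => ?_)
  by_cases hz : z ∈ tsupport φ
  · have hz' := hs hz
    have h1 : HasFDerivAt h ((fderiv ℂ h z).restrictScalars ℝ) z :=
      ((hh.differentiableAt (isOpen_upperPlane.mem_nhds hz')).hasFDerivAt).restrictScalars ℝ
    have h2 : HasFDerivAt φ (fderiv ℝ φ z) z := (hφ.differentiable (by simp) z).hasFDerivAt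
    have h3 : fderiv ℂ h z I = I * fderiv ℂ h z 1 := by
      have := (fderiv ℂ h z).map_smul I 1
      simpa only [smul_eq_mul, mul_one] using this
    have h4 : fderiv ℝ (fun z => h z * φ z) z = _ := (h1.mul h2).fderiv
    simp only [dbar]
    rw [h4]
    simp [h3]
    linear_combination (-(1 / 2) * φ z * deriv h z) * I_sq
  · simp only [dbar_eq_zero_of_notMem_tsupport hz,
      dbar_eq_zero_of_notMem_tsupport fun h => hz (hsub h), mul_zero]

/-! ### The Poisson formula and the pairings of h_b with the Poisson kernel -/

lemma poissonP_eq {y : ℝ} (hy : 0 < y) (x t : ℝ) :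
    poissonP (x - t) y = y⁻¹ * (1 + ((t - x) / y) ^ 2)⁻¹ := by
  rw [poissonP]
  have : 0 < (x - t) ^ 2 + y ^ 2 := by positivity
  field_simp
  ring

lemma integrable_poissonP {y : ℝ} (hy : 0 < y) (x : ℝ) :
    Integrable fun t => poissonP (x - t) y := by
  simp only [poissonP_eq hy]
  exact (((integrable_inv_one_add_sq.comp_div hy.ne').comp_sub_right x)).const_mul _

lemma integral_poissonP {y : ℝ} (hy : 0 < y) (x : ℝ) :
    ∫ t, poissonP (x - t) y = Real.pi := by
  simp only [poissonP_eq hy]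
  rw [integral_const_mul, integral_sub_right_eq_self (fun t => (1 + (t / y) ^ 2)⁻¹) x,
    Measure.integral_comp_div (fun t => (1 + t ^ 2)⁻¹) y, integral_univ_inv_one_add_sq,
    abs_of_pos hy, smul_eq_mul]
  field_simp

lemma isOpen_halfPlane (s : ℝ) : IsOpen {w : ℂ | -s < w.im} :=
  isOpen_lt continuous_const Complex.continuous_im

section

variable {s M : ℝ} {g : ℂ → ℂ}

/-- Subtracting g(z) removes the Poisson kernel's pole at z, and the other pole lies in ℂ₋. -/
lemma differentiableOn_poissonQuotient (hg : DifferentiableOn ℂ g {w : ℂ | -s < w.im}) {z : ℂ}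
    (hs : 0 < s) (hz : 0 < z.im) : DifferentiableOn ℂ
      (fun w => dslope g z w / (w - (starRingEnd ℂ) z)) {w : ℂ | 0 ≤ w.im} := by
  have h1 : DifferentiableOn ℂ (dslope g z) {w : ℂ | -s < w.im} :=
    (Complex.differentiableOn_dslope ((isOpen_halfPlane s).mem_nhds
      (show -s < z.im by linarith))).2 hg
  refine (h1.mono fun w hw => ?_).div (by fun_prop) fun w hw h => ?_
  · have : 0 ≤ w.im := hw
    show -s < w.im
    linarith
  · have h2 : w.im = ((starRingEnd ℂ) z).im := by rw [sub_eq_zero.1 h]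
    have : 0 ≤ w.im := hw
    rw [Complex.conj_im] at h2
    linarith

lemma norm_poissonQuotient_le (hM : ∀ w : ℂ, 0 ≤ w.im → ‖g w‖ ≤ M) {z w : ℂ} (hz : 0 < z.im)
    (hw : 0 ≤ w.im) {R : ℝ} (hR : 2 * ‖z‖ < R) (hwR : R ≤ ‖w‖) :
    ‖dslope g z w / (w - (starRingEnd ℂ) z)‖ ≤ 8 * M / R ^ 2 := by
  have hR0 : 0 < R := lt_of_le_of_lt (by positivity) hR
  have h1 : R / 2 ≤ ‖w - z‖ := by
    have := norm_sub_norm_le w z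
    linarith
  have h2 : R / 2 ≤ ‖w - (starRingEnd ℂ) z‖ := by
    have := norm_sub_norm_le w ((starRingEnd ℂ) z)
    rw [Complex.norm_conj] at this
    linarith
  have hne : w ≠ z := by
    rintro rfl
    rw [sub_self, norm_zero] at h1
    linarith
  have h3 : ‖g w - g z‖ ≤ 2 * M := by
    have := norm_sub_le (g w) (g z)
    have := hM w hw
    have := hM z hz.le
    linarith
  have hM0 : 0 ≤ M := (norm_nonneg _).trans (hM w hw)
  rw [dslope_of_ne _ hne, slope_def_field, norm_div, norm_div, div_div]
  calc ‖g w - g z‖ / (‖w - z‖ * ‖w - (starRingEnd ℂ) z‖) ≤ 2 * M / (R / 2 * (R / 2)) := by gcongr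
    _ = 8 * M / R ^ 2 := by field_simp; ring

/-- Cauchy's theorem on the rectangle [-R, R] × [0, R] moves the integral to the other three sides:
total length 4R, integrand at most 8M/R². -/
lemma norm_integral_poissonQuotient_le (hg : DifferentiableOn ℂ g {w : ℂ | -s < w.im})
    (hs : 0 < s) (hM : ∀ w : ℂ, 0 ≤ w.im → ‖g w‖ ≤ M) {z : ℂ} (hz : 0 < z.im) {R : ℝ}
    (hR : 2 * ‖z‖ < R) :
    ‖∫ t : ℝ in (-R)..R, dslope g z t / (t - (starRingEnd ℂ) z)‖ ≤ 32 * M / R := by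
  have hR0 : 0 < R := lt_of_le_of_lt (by positivity) hR
  set G : ℂ → ℂ := fun w => dslope g z w / (w - (starRingEnd ℂ) z) with hG
  have hrect := integral_boundary_rect_eq_zero_of_differentiableOn G ⟨-R, 0⟩ ⟨R, R⟩
    ((differentiableOn_poissonQuotient hg hs hz).mono fun w hw => by
      have := hw.2
      simp only [Set.uIcc_of_le hR0.le, Set.mem_preimage] at this
      exact this.1)
  simp only [ofReal_zero, zero_mul, add_zero] at hrect
  have b : ∀ w : ℂ, 0 ≤ w.im → R ≤ ‖w‖ → ‖G w‖ ≤ 8 * M / R ^ 2 := fun w hw hwR =>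
    norm_poissonQuotient_le hM hz hw hR hwR
  have b1 : ‖∫ x : ℝ in (-R)..R, G (x + R * I)‖ ≤ 8 * M / R ^ 2 * |R - -R| :=
    intervalIntegral.norm_integral_le_of_norm_le_const fun x _ => b _ (by simpa using hR0.le) (by
      have := Complex.abs_im_le_norm (x + R * I)
      simp only [add_im, ofReal_im, mul_im, ofReal_re, I_im, mul_one, I_re, mul_zero, add_zero,
        zero_add, abs_of_pos hR0] at this
      exact this)
  have hside : ∀ a : ℝ, |a| = R → ‖∫ y : ℝ in (0 : ℝ)..R, G (a + y * I)‖ ≤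
      8 * M / R ^ 2 * |R - 0| := fun a ha =>
    intervalIntegral.norm_integral_le_of_norm_le_const fun y hy => by
      rw [Set.uIoc_of_le hR0.le] at hy
      refine b _ (by simpa using hy.1.le) ?_
      have := Complex.abs_re_le_norm (a + y * I)
      simp only [add_re, ofReal_re, mul_re, I_re, mul_zero, ofReal_im, I_im, mul_one, sub_self,
        add_zero, ha] at this
      exact this
  have b2 := hside R (abs_of_pos hR0)
  have b3 := hside (-R) (by rw [abs_neg, abs_of_pos hR0])
  have e : ∫ t : ℝ in (-R)..R, G t = (∫ x : ℝ in (-R)..R, G (x + R * I)) -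
      I • (∫ y : ℝ in (0 : ℝ)..R, G (R + y * I)) +
      I • (∫ y : ℝ in (0 : ℝ)..R, G ((-R : ℝ) + y * I)) := by
    linear_combination hrect
  have hI : ∀ w : ℂ, ‖I • w‖ = ‖w‖ := fun w => by rw [norm_smul, Complex.norm_I, one_mul]
  change ‖∫ t : ℝ in (-R)..R, G t‖ ≤ _
  rw [e]
  refine (norm_add_le _ _).trans ((add_le_add_left (norm_sub_le _ _) _).trans ?_)
  rw [hI, hI]
  rw [show |R - -R| = 2 * R by rw [sub_neg_eq_add, abs_of_pos (by linarith)]; ring] at b1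
  rw [sub_zero, abs_of_pos hR0] at b2 b3
  have : 32 * M / R = 8 * M / R ^ 2 * (2 * R) + 8 * M / R ^ 2 * R + 8 * M / R ^ 2 * R := by
    field_simp; ring
  linarith

lemma poissonQuotient_mul {z : ℂ} (hz : 0 < z.im) (t : ℝ) :
    (g t - g z) * (poissonP (z.re - t) z.im : ℂ) =
      z.im * (dslope g z t / (t - (starRingEnd ℂ) z)) := by
  have h1 : (t : ℂ) ≠ z := fun h => by
    have := congrArg Complex.im h
    simp at this
    linarith
  have h2 : (t : ℂ) - (starRingEnd ℂ) z ≠ 0 := fun h => by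
    have := congrArg Complex.im h
    simp at this
    linarith
  have h3 : ((t : ℂ) - z) * (t - (starRingEnd ℂ) z) = (((z.re - t) ^ 2 + z.im ^ 2 : ℝ) : ℂ) := by
    apply Complex.ext <;> simp [pow_two] <;> ring
  have h4 : (t : ℂ) - z ≠ 0 := sub_ne_zero.2 h1
  rw [dslope_of_ne _ h1, slope_def_field, poissonP, ofReal_div, ← h3]
  field_simp

lemma integrable_mul_poissonP (hg : DifferentiableOn ℂ g {w : ℂ | -s < w.im}) (hs : 0 < s)
    (hM : ∀ w : ℂ, 0 ≤ w.im → ‖g w‖ ≤ M) {z : ℂ} (hz : 0 < z.im) :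
    Integrable fun t : ℝ => g t * (poissonP (z.re - t) z.im : ℂ) := by
  refine (integrable_poissonP hz z.re).ofReal.bdd_mul (c := M) ?_ ?_
  · have : Continuous fun t : ℝ => g t :=
      hg.continuousOn.comp_continuous continuous_ofReal fun t => by simpa using hs
    exact this.aestronglyMeasurable
  · exact Eventually.of_forall fun t => hM t (by simp)

/-- The Poisson formula for bounded holomorphic functions on the upper half-plane. -/
lemma integral_mul_poissonP (hg : DifferentiableOn ℂ g {w : ℂ | -s < w.im}) (hs : 0 < s)
    (hM : ∀ w : ℂ, 0 ≤ w.im → ‖g w‖ ≤ M) {z : ℂ} (hz : 0 < z.im) :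
    ∫ t : ℝ, g t * (poissonP (z.re - t) z.im : ℂ) = Real.pi * g z := by
  have i1 := integrable_mul_poissonP hg hs hM hz
  have i2 : Integrable fun t : ℝ => g z * (poissonP (z.re - t) z.im : ℂ) :=
    (integrable_poissonP hz z.re).ofReal.const_mul _
  have i3 : Integrable fun t : ℝ => (g t - g z) * (poissonP (z.re - t) z.im : ℂ) := by
    simp only [sub_mul]
    exact i1.sub i2
  have h0 : ∫ t : ℝ, (g t - g z) * (poissonP (z.re - t) z.im : ℂ) = 0 := by
    refine tendsto_nhds_unique
      (intervalIntegral_tendsto_integral i3 tendsto_neg_atTop_atBot tendsto_id) ?_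
    simp only [poissonQuotient_mul hz, id, intervalIntegral.integral_const_mul]
    rw [← mul_zero (z.im : ℂ)]
    refine Tendsto.const_mul _ (squeeze_zero_norm' (a := fun R => 32 * M / R) ?_
      (tendsto_const_nhds.div_atTop tendsto_id))
    filter_upwards [eventually_gt_atTop (2 * ‖z‖)] with R hR
    exact norm_integral_poissonQuotient_le hg hs hM hz hR
  simp only [sub_mul] at h0
  rw [integral_sub i1 i2, integral_const_mul, integral_complex_ofReal, integral_poissonP hz] at h0
  linear_combination h0

end

section

variable {h : ℂ → ℂ}

/-- Lifting by s makes h holomorphic across ℝ and bounded by C/s^N on the closed half-plane, as the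
Poisson formula requires. -/
lemma TemperedGrowth.shift (hh : TemperedGrowth h) {s : ℝ} (hs : 0 < s) :
    DifferentiableOn ℂ (fun w => h (w + s * I)) {w : ℂ | -s < w.im} ∧
      ∃ M : ℝ, ∀ w : ℂ, 0 ≤ w.im → ‖h (w + s * I)‖ ≤ M := by
  obtain ⟨hd, N, -, C, hC⟩ := hh
  refine ⟨hd.comp (by fun_prop) fun w hw => ?_, C / s ^ N, fun w hw => ?_⟩
  · have : -s < w.im := hw
    simp [upperPlane]
    linarith
  · have h1 : w + s * I ∈ upperPlane := by
      simp [upperPlane]; linarith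
    have h2 := hC _ h1
    have h3 : (w + s * I).im = w.im + s := by simp
    rw [h3] at h2
    have hC0 : 0 ≤ C := by
      have := hC I (by simp [upperPlane])
      simp only [I_im, one_pow, div_one] at this
      exact (norm_nonneg _).trans this
    refine h2.trans ?_
    gcongr
    linarith

lemma TemperedGrowth.linePairing_poissonP (hh : TemperedGrowth h) {z : ℂ} (hz : z ∈ upperPlane)
    {s : ℝ} (hs : 0 < s) :
    Integrable (fun t : ℝ => h (t + s * I) * (poissonP (z.re - t) z.im : ℂ)) ∧
    linePairing h (fun t => poissonP (z.re - t) z.im) s = Real.pi * h (z + s * I) := by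
  obtain ⟨hd, M, hM⟩ := hh.shift hs
  exact ⟨integrable_mul_poissonP hd hs hM hz, integral_mul_poissonP hd hs hM hz⟩

lemma TemperedGrowth.hasBoundaryPairing (hh : TemperedGrowth h) {z : ℂ} (hz : z ∈ upperPlane) :
    HasBoundaryPairing h (fun t => poissonP (z.re - t) z.im) (Real.pi * h z) := by
  refine ⟨?_, ?_⟩
  · filter_upwards [self_mem_nhdsWithin] with s hs
    exact (hh.linePairing_poissonP hz hs).1
  · have hc : Tendsto (fun s : ℝ => (Real.pi : ℂ) * h (z + s * I)) (𝓝[>] 0)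
        (𝓝 (Real.pi * h z)) := by
      refine Tendsto.const_mul _ ?_
      have h1 : ContinuousAt h z :=
        (hh.1.differentiableAt (isOpen_upperPlane.mem_nhds hz)).continuousAt
      have h2 : Tendsto (fun s : ℝ => z + s * I) (𝓝[>] 0) (𝓝 z) := by
        have : Continuous fun s : ℝ => z + s * I := by fun_prop
        simpa using (this.tendsto 0).mono_left nhdsWithin_le_nhds
      exact h1.tendsto.comp h2
    refine hc.congr' ?_
    filter_upwards [self_mem_nhdsWithin] with s hs
    exact (hh.linePairing_poissonP hz hs).2.symm

lemma TemperedGrowth.boundaryPairing_eq (hh : TemperedGrowth h) {z : ℂ} (hz : z ∈ upperPlane) :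
    boundaryPairing h (fun t => poissonP (z.re - t) z.im) = Real.pi * h z :=
  (hh.hasBoundaryPairing hz).2.limUnder_eq

lemma TemperedGrowth.poissonOfBoundary_eq (hh : TemperedGrowth h) {z : ℂ} (hz : z ∈ upperPlane) :
    poissonOfBoundary h z = h z := by
  have hπ : (Real.pi : ℂ) ≠ 0 := by exact_mod_cast Real.pi_ne_zero
  rw [poissonOfBoundary, hh.boundaryPairing_eq hz]
  field_simp

lemma poissonP_I_sub : (fun t => poissonP (I.re - t) I.im) = fun t => poissonP t 1 := by
  funext t
  simp [poissonP]

lemma I_mem_upperPlane : I ∈ upperPlane := by simp [upperPlane]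

lemma TemperedGrowth.imCorrection_eq (hh : TemperedGrowth h) :
    imCorrection h = I * ((h I).im : ℂ) := by
  have hπ : (Real.pi : ℂ) ≠ 0 := by exact_mod_cast Real.pi_ne_zero
  rw [imCorrection, ← poissonP_I_sub, hh.boundaryPairing_eq I_mem_upperPlane, im_ofReal_mul,
    ofReal_mul]
  field_simp

end

/-! ### Distributional boundary values -/

/-- Real test functions on the line. -/
abbrev RealTest := 𝓓((⊤ : TopologicalSpace.Opens ℝ), ℝ)

/-- Complex distributions on the line. -/
abbrev ComplexDistrib := 𝓓'((⊤ : TopologicalSpace.Opens ℝ), ℂ)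

/-- The derivative of a test function. -/
noncomputable def testDeriv (φ : RealTest) : RealTest := TestFunction.lineDerivCLM ℝ (1 : ℝ) φ

lemma testDeriv_apply (φ : RealTest) (x : ℝ) : testDeriv φ x = deriv φ x := by
  rw [testDeriv, TestFunction.lineDerivCLM_apply_of_le (by simp)]
  rw [(φ.contDiff.differentiable (by simp) x).lineDeriv_eq_fderiv, fderiv_eq_deriv_mul, mul_one]

lemma RealTest.hasDerivAt (φ : RealTest) (x : ℝ) : HasDerivAt φ (testDeriv φ x) x := by
  rw [testDeriv_apply]
  exact (φ.contDiff.differentiable (by simp) x).hasDerivAt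

lemma RealTest.integrable (φ : RealTest) : Integrable φ :=
  φ.continuous.integrable_of_hasCompactSupport φ.hasCompactSupport

lemma RealTest.integrable_ofReal (φ : RealTest) : Integrable fun x => (φ x : ℂ) :=
  (RealTest.integrable φ).ofReal

lemma exists_distrib_of_locallyIntegrable {m : ℝ → ℂ} (hm : LocallyIntegrable m) :
    ∃ T : ComplexDistrib, ∀ φ, T φ = ∫ x, m x * (φ x : ℂ) := by
  refine ⟨(TestFunction.integralAgainstBilinCLM (ContinuousLinearMap.lsmul ℝ ℝ) volume m :
    RealTest →L[ℝ] ℂ), fun φ => ?_⟩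
  refine (TestFunction.integralAgainstBilinCLM_eq_integral (hm.locallyIntegrableOn _)).trans ?_
  simp [mul_comm]

lemma exists_distrib_combination (a b : ℂ) (T₁ T₂ : ComplexDistrib) :
    ∃ T : ComplexDistrib, ∀ φ, T φ = a * T₁ φ + b * T₂ (testDeriv φ) := by
  refine ⟨Distribution.mapCLM (ContinuousLinearMap.mul ℝ ℂ a) T₁ -
    Distribution.mapCLM (ContinuousLinearMap.mul ℝ ℂ b) (Distribution.lineDerivCLM (1 : ℝ) T₂),
    fun φ => ?_⟩
  -- Differentiating a distribution puts -φ' in its argument, hence the subtraction above.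
  change a * T₁ φ - b * -(T₂ (testDeriv φ)) = _
  ring

lemma continuous_mul_test_integrable {k : ℝ → ℂ} (hk : Continuous k) (φ : RealTest) :
    Integrable fun x => k x * (φ x : ℂ) :=
  (hk.mul (continuous_ofReal.comp φ.continuous)).integrable_of_hasCompactSupport
    (φ.hasCompactSupport.comp_left (g := fun x : ℝ => (x : ℂ)) rfl).mul_left

lemma exists_isBoundaryValue_of_continuous {Ψ : ℂ → ℂ} (hΨ : Continuous Ψ) :
    ∃ T : ComplexDistrib, IsBoundaryValue Ψ T ∧ ∀ φ, T φ = ∫ x : ℝ, Ψ x * (φ x : ℂ) := by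
  obtain ⟨T, hT⟩ := exists_distrib_of_locallyIntegrable
    (hΨ.comp continuous_ofReal).locallyIntegrable
  refine ⟨T, fun φ => ⟨Eventually.of_forall fun y => ?_, ?_⟩, hT⟩
  · exact continuous_mul_test_integrable (hΨ.comp (by fun_prop)) φ
  · have e : ∀ y : ℝ, linePairing Ψ φ y =
        ∫ x in tsupport φ, Ψ (x + y * I) * (φ x : ℂ) := fun y => by
      refine (setIntegral_eq_integral_of_forall_compl_eq_zero fun x hx => ?_).symm
      rw [image_eq_zero_of_notMem_tsupport hx, ofReal_zero, mul_zero]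
    have hc : Continuous (linePairing Ψ φ) := by
      rw [funext e]
      refine continuous_parametric_integral_of_continuous ?_ φ.hasCompactSupport
      have := φ.continuous
      unfold Function.uncurry
      fun_prop
    have h0 : linePairing Ψ φ 0 = T φ := by
      rw [hT]
      simp [linePairing]
    rw [← h0]
    exact (hc.tendsto 0).mono_left nhdsWithin_le_nhds

section

variable {h : ℂ → ℂ}

lemma TemperedGrowth.continuous_line (hh : TemperedGrowth h) {s : ℝ} (hs : 0 < s) :
    Continuous fun x : ℝ => h (x + s * I) :=
  hh.1.continuousOn.comp_continuous (by fun_prop) fun x => by simpa [upperPlane] using hs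

/-- Cauchy's estimate on discs of radius s/4, which stay above height s/2. -/
lemma TemperedGrowth.exists_deriv_bound (hh : TemperedGrowth h) {s : ℝ} (hs : 0 < s) :
    ∃ B : ℝ, ∀ z : ℂ, s ≤ z.im → ‖deriv h z‖ ≤ B := by
  obtain ⟨hd, M, hM⟩ := hh.shift (half_pos hs)
  refine ⟨M / (s / 4), fun z hz => ?_⟩
  have him : ∀ w : ℂ, ‖w - z‖ ≤ s / 4 → s / 2 < w.im := fun w hw => by
    have h1 := (Complex.abs_im_le_norm (w - z)).trans hw
    rw [Complex.sub_im] at h1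
    linarith [(abs_le.1 h1).1]
  refine Complex.norm_deriv_le_of_forall_mem_sphere_norm_le (by positivity) ?_ fun w hw => ?_
  · refine (hh.1.mono fun w hw => ?_).diffContOnCl
    have := closure_minimal (Metric.ball_subset_closedBall) Metric.isClosed_closedBall hw
    rw [mem_closedBall_iff_norm] at this
    exact (half_pos hs).trans (him w this)
  · have h1 := him w (mem_sphere_iff_norm.1 hw).le
    have h2 := hM (w - (s / 2 : ℝ) * I) (by simp; linarith)
    simpa using h2

/-- By Cauchy–Riemann ∂_s h = i ∂_x h; integration by parts moves ∂_x onto φ. Differentiation in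
height thus becomes differentiation of the test function. -/
lemma TemperedGrowth.hasDerivAt_linePairing (hh : TemperedGrowth h) (φ : RealTest) {s : ℝ}
    (hs : 0 < s) :
    HasDerivAt (linePairing h φ) (-I * linePairing h (testDeriv φ) s) s := by
  obtain ⟨B, hB⟩ := hh.exists_deriv_bound (half_pos hs)
  have hder : ∀ z ∈ upperPlane, HasDerivAt h (deriv h z) z := fun z hz =>
    (hh.1.differentiableAt (isOpen_upperPlane.mem_nhds hz)).hasDerivAt
  have hmem : ∀ (x : ℝ) {t : ℝ}, 0 < t → (x + t * I : ℂ) ∈ upperPlane := fun x t ht => by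
    simpa [upperPlane] using ht
  have hdcont : Continuous fun x : ℝ => deriv h (x + s * I) :=
    (hh.1.deriv isOpen_upperPlane).continuousOn.comp_continuous (by fun_prop) fun x => hmem x hs
  have hball : ∀ t ∈ Metric.ball s (s / 2), s / 2 < t := fun t ht => by
    rw [Real.ball_eq_Ioo] at ht
    linarith [ht.1]
  have key := hasDerivAt_integral_of_dominated_loc_of_deriv_le (μ := (volume : Measure ℝ))
    (F := fun (t x : ℝ) => h (x + t * I) * (φ x : ℂ))
    (F' := fun (t x : ℝ) => (I * deriv h (x + t * I)) * (φ x : ℂ)) (x₀ := s)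
    (s := Metric.ball s (s / 2)) (bound := fun x => B * |φ x|)
    (Metric.ball_mem_nhds _ (half_pos hs))
    (by
      filter_upwards [eventually_gt_nhds hs] with t ht
      exact (continuous_mul_test_integrable (hh.continuous_line ht) φ).1)
    (continuous_mul_test_integrable (hh.continuous_line hs) φ)
    (continuous_mul_test_integrable (continuous_const.mul hdcont) φ).1
    (Eventually.of_forall fun x t ht => by
      rw [norm_mul, norm_mul, Complex.norm_I, one_mul, Complex.norm_real, Real.norm_eq_abs]
      exact mul_le_mul_of_nonneg_right (hB _ (by simpa using (hball t ht).le)) (abs_nonneg _))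
    ((RealTest.integrable φ).abs.const_mul B)
    (Eventually.of_forall fun x t ht => by
      have h1 : HasDerivAt (fun t : ℝ => (x : ℂ) + t * I) (1 * I) t :=
        ((hasDerivAt_id t).ofReal_comp.mul_const I).const_add (x : ℂ)
      have h2 := (hder _ (hmem x (by linarith [hball t ht] : 0 < t))).comp t h1
      refine (h2.mul_const (φ x : ℂ)).congr_deriv (by ring))
  refine key.2.congr_deriv ?_
  have hparts := integral_mul_deriv_eq_deriv_mul_of_integrable
    (u := fun x : ℝ => h (x + s * I)) (u' := fun x : ℝ => deriv h (x + s * I))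
    (v := fun x => (φ x : ℂ)) (v' := fun x => (testDeriv φ x : ℂ))
    (fun x _ => by
      have h1 : HasDerivAt (fun x : ℝ => (x : ℂ) + s * I) 1 x :=
        (hasDerivAt_id x).ofReal_comp.add_const _
      exact ((hder _ (hmem x hs)).comp x h1).congr_deriv (mul_one _))
    (fun x _ => (RealTest.hasDerivAt φ x).ofReal_comp)
    (continuous_mul_test_integrable (hh.continuous_line hs) _)
    (continuous_mul_test_integrable hdcont φ)
    (continuous_mul_test_integrable (hh.continuous_line hs) φ)
  rw [linePairing, hparts, ← integral_neg, ← integral_const_mul]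
  refine integral_congr_ae (Eventually.of_forall fun x => ?_)
  ring

/-- The iterated height integrals `∫_y^1 (s - y)^k ⟨h(· + is), φ⟩ ds`. -/
noncomputable def heightIntegral (h : ℂ → ℂ) (k : ℕ) (φ : RealTest) (y : ℝ) : ℂ :=
  ∫ s in y..1, ((s - y : ℝ) : ℂ) ^ k * linePairing h φ s

lemma TemperedGrowth.continuousOn_linePairing (hh : TemperedGrowth h) (φ : RealTest) :
    ContinuousOn (linePairing h φ) (Set.Ioi 0) := fun _ hs =>
  (hh.hasDerivAt_linePairing φ hs).continuousAt.continuousWithinAt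

lemma TemperedGrowth.intervalIntegrable (hh : TemperedGrowth h) (k : ℕ) (φ : RealTest) {y : ℝ}
    (hy : 0 < y) (hy1 : y ≤ 1) :
    IntervalIntegrable (fun s => ((s - y : ℝ) : ℂ) ^ k * linePairing h φ s) volume y 1 := by
  refine ContinuousOn.intervalIntegrable ?_
  refine ContinuousOn.mul (Continuous.continuousOn (by fun_prop))
    ((hh.continuousOn_linePairing φ).mono fun s hs => ?_)
  rw [Set.uIcc_of_le hy1] at hs
  exact hy.trans_le hs.1

/-- Integration by parts in s; the boundary term at s = y vanishes, leaving the one at height 1. -/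
lemma TemperedGrowth.heightIntegral_succ (hh : TemperedGrowth h) (k : ℕ) (φ : RealTest) {y : ℝ}
    (hy : 0 < y) (hy1 : y ≤ 1) :
    (k + 1 : ℂ) * heightIntegral h k φ y = ((1 - y : ℝ) : ℂ) ^ (k + 1) * linePairing h φ 1 +
      I * heightIntegral h (k + 1) (testDeriv φ) y := by
  have hd : ∀ s ∈ Set.uIcc y 1, HasDerivAt
      (fun s : ℝ => ((s - y : ℝ) : ℂ) ^ (k + 1) * linePairing h φ s)
      ((k + 1 : ℂ) * (((s - y : ℝ) : ℂ) ^ k * linePairing h φ s) -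
        I * (((s - y : ℝ) : ℂ) ^ (k + 1) * linePairing h (testDeriv φ) s)) s := by
    intro s hs
    rw [Set.uIcc_of_le hy1] at hs
    have h1 : HasDerivAt (fun s : ℝ => ((s - y : ℝ) : ℂ)) ((1 : ℝ) : ℂ) s :=
      ((hasDerivAt_id s).sub_const y).ofReal_comp
    refine ((h1.pow (k + 1)).mul (hh.hasDerivAt_linePairing φ (hy.trans_le hs.1))).congr_deriv ?_
    simp
    ring
  have i1 := (hh.intervalIntegrable k φ hy hy1).const_mul (k + 1 : ℂ)
  have i2 := (hh.intervalIntegrable (k + 1) (testDeriv φ) hy hy1).const_mul I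
  have := intervalIntegral.integral_eq_sub_of_hasDerivAt hd (i1.sub i2)
  rw [intervalIntegral.integral_sub i1 i2, intervalIntegral.integral_const_mul,
    intervalIntegral.integral_const_mul, sub_self, ofReal_zero, zero_pow (Nat.succ_ne_zero k),
    zero_mul, sub_zero] at this
  rw [heightIntegral, heightIntegral]
  linear_combination this

lemma TemperedGrowth.linePairing_eq (hh : TemperedGrowth h) (φ : RealTest) {y : ℝ}
    (hy : 0 < y) (hy1 : y ≤ 1) :
    linePairing h φ y = linePairing h φ 1 + I * heightIntegral h 0 (testDeriv φ) y := by
  have i := (hh.intervalIntegrable 0 (testDeriv φ) hy hy1).const_mul (-I)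
  simp only [pow_zero, one_mul] at i
  have := intervalIntegral.integral_eq_sub_of_hasDerivAt (fun s hs => by
    rw [Set.uIcc_of_le hy1] at hs
    exact hh.hasDerivAt_linePairing φ (hy.trans_le hs.1)) i
  rw [intervalIntegral.integral_const_mul] at this
  simp only [heightIntegral, pow_zero, one_mul]
  linear_combination this

end

section

variable {h : ℂ → ℂ}

lemma norm_pow_mul_le {N : ℕ} {C : ℝ} (hC : ∀ z ∈ upperPlane, ‖h z‖ ≤ C / z.im ^ N) (x : ℝ) {s : ℝ}
    (hs : 0 < s) : ‖(s : ℂ) ^ N * h (x + s * I)‖ ≤ C := by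
  have h1 := hC (x + s * I) (by simpa [upperPlane] using hs)
  simp only [add_im, ofReal_im, mul_im, ofReal_re, I_im, mul_one, I_re, mul_zero, add_zero,
    zero_add] at h1
  rw [le_div_iff₀ (by positivity)] at h1
  rw [norm_mul, norm_pow, Complex.norm_real, Real.norm_of_nonneg hs.le]
  linarith

lemma norm_linePairing_le {N : ℕ} {C : ℝ} (hC : ∀ z ∈ upperPlane, ‖h z‖ ≤ C / z.im ^ N)
    (φ : RealTest) {s : ℝ} (hs : 0 < s) :
    ‖(s : ℂ) ^ N * linePairing h φ s‖ ≤ C * ∫ x, |φ x| := by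
  rw [linePairing, ← integral_const_mul, ← integral_const_mul]
  refine norm_integral_le_of_norm_le ((RealTest.integrable φ).abs.const_mul C)
    (Eventually.of_forall fun x => ?_)
  rw [← mul_assoc, norm_mul, Complex.norm_real, Real.norm_eq_abs]
  exact mul_le_mul_of_nonneg_right (norm_pow_mul_le hC x hs) (abs_nonneg _)

lemma tendsto_heightIntegral (hh : TemperedGrowth h) {N : ℕ} {C : ℝ}
    (hC : ∀ z ∈ upperPlane, ‖h z‖ ≤ C / z.im ^ N) (φ : RealTest) :
    Tendsto (heightIntegral h N φ) (𝓝[>] 0)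
      (𝓝 (∫ s in Set.Ioc (0 : ℝ) 1, (s : ℂ) ^ N * linePairing h φ s)) := by
  have hLc : AEStronglyMeasurable (linePairing h φ) (volume.restrict (Set.Ioc (0 : ℝ) 1)) :=
    ((hh.continuousOn_linePairing φ).mono fun s hs => hs.1).aestronglyMeasurable measurableSet_Ioc
  -- An indicator replaces the moving lower limit y; since 0 ≤ s - y ≤ s, the bound on s^N h
  -- dominates.
  have key : Tendsto (fun y => ∫ s in Set.Ioc (0 : ℝ) 1,
      (Set.Ioi y).indicator (fun s => ((s - y : ℝ) : ℂ) ^ N * linePairing h φ s) s) (𝓝[>] 0)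
      (𝓝 (∫ s in Set.Ioc (0 : ℝ) 1, (s : ℂ) ^ N * linePairing h φ s)) := by
    refine tendsto_integral_filter_of_dominated_convergence (fun _ => C * ∫ x, |φ x|) ?_ ?_
      (integrable_const _) ?_
    · refine Eventually.of_forall fun y => AEStronglyMeasurable.indicator ?_ measurableSet_Ioi
      exact (Continuous.aestronglyMeasurable (by fun_prop)).mul hLc
    · filter_upwards [self_mem_nhdsWithin] with y hy
      filter_upwards [ae_restrict_mem measurableSet_Ioc] with s hs
      have h0 := norm_linePairing_le hC φ hs.1
      by_cases hys : s ∈ Set.Ioi y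
      · rw [Set.indicator_of_mem hys]
        refine le_trans ?_ h0
        rw [norm_mul, norm_mul, norm_pow, norm_pow, Complex.norm_real, Complex.norm_real,
          Real.norm_of_nonneg hs.1.le, Real.norm_of_nonneg (sub_nonneg.2 (le_of_lt hys))]
        have hy' : 0 < y := hy
        have hys' : y < s := hys
        gcongr
        linarith
      · rw [Set.indicator_of_notMem hys, norm_zero]
        exact (norm_nonneg _).trans h0
    · filter_upwards [ae_restrict_mem measurableSet_Ioc] with s hs
      have hc : Tendsto (fun y : ℝ => ((s - y : ℝ) : ℂ) ^ N * linePairing h φ s) (𝓝[>] 0)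
          (𝓝 ((s : ℂ) ^ N * linePairing h φ s)) := by
        have : Continuous fun y : ℝ => ((s - y : ℝ) : ℂ) ^ N * linePairing h φ s := by fun_prop
        simpa using (this.tendsto 0).mono_left nhdsWithin_le_nhds
      refine hc.congr' ?_
      filter_upwards [mem_nhdsWithin_of_mem_nhds (eventually_lt_nhds hs.1)] with y hy
      rw [Set.indicator_of_mem (show s ∈ Set.Ioi y from hy)]
  refine key.congr' ?_
  filter_upwards [Ioc_mem_nhdsGT (zero_lt_one' ℝ)] with y hy
  rw [setIntegral_indicator measurableSet_Ioi, heightIntegral,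
    intervalIntegral.integral_of_le hy.2]
  congr 2
  ext s
  simp only [Set.mem_inter_iff, Set.mem_Ioc, Set.mem_Ioi]
  exact ⟨fun hs => ⟨hs.2, hs.1.2⟩, fun hs => ⟨⟨hy.1.trans hs.1, hs.2⟩, hs.1⟩⟩

/-- By Fubini the limit is integration of φ against the bounded function x ↦ ∫₀¹ s^N h(x + is) ds,
hence a distribution. -/
lemma exists_distrib_base (hh : TemperedGrowth h) {N : ℕ} {C : ℝ}
    (hC : ∀ z ∈ upperPlane, ‖h z‖ ≤ C / z.im ^ N) :
    ∃ T : ComplexDistrib, ∀ φ, Tendsto (heightIntegral h N φ) (𝓝[>] 0) (𝓝 (T φ)) := by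
  set μ := volume.restrict (Set.Ioc (0 : ℝ) 1) with hμ
  have hk : AEStronglyMeasurable (fun p : ℝ × ℝ => (p.2 : ℂ) ^ N * h (p.1 + p.2 * I))
      (volume.prod μ) := by
    have : (volume : Measure ℝ).prod μ =
        (volume.prod volume).restrict (Set.univ ×ˢ Set.Ioc (0 : ℝ) 1) := by
      rw [← Measure.prod_restrict, Measure.restrict_univ]
    rw [this]
    refine ContinuousOn.aestronglyMeasurable ?_ (MeasurableSet.univ.prod measurableSet_Ioc)
    refine ContinuousOn.mul (Continuous.continuousOn (by fun_prop))
      (hh.1.continuousOn.comp (Continuous.continuousOn (by fun_prop)) fun p hp => ?_)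
    simpa [upperPlane] using hp.2.1
  have hbd : ∀ x : ℝ, ‖∫ s, (s : ℂ) ^ N * h (x + s * I) ∂μ‖ ≤ C := fun x => by
    have := norm_integral_le_of_norm_le (μ := μ) (integrable_const C) (by
      filter_upwards [ae_restrict_mem measurableSet_Ioc] with s hs
      exact norm_pow_mul_le hC x hs.1)
    simpa [hμ] using this
  have hloc : LocallyIntegrable fun x : ℝ => ∫ s, (s : ℂ) ^ N * h (x + s * I) ∂μ := by
    refine (locallyIntegrable_const C).mono hk.integral_prod_right'
      (Eventually.of_forall fun x => (hbd x).trans (Real.le_norm_self C))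
  obtain ⟨T, hT⟩ := exists_distrib_of_locallyIntegrable hloc
  refine ⟨T, fun φ => ?_⟩
  have hint : Integrable (fun p : ℝ × ℝ => ((p.2 : ℂ) ^ N * h (p.1 + p.2 * I)) * (φ p.1 : ℂ))
      (volume.prod μ) := by
    have hφ := (RealTest.integrable_ofReal φ).comp_fst μ
    refine Integrable.mono' (hφ.norm.const_mul C) (hk.mul hφ.1) ?_
    have : ∀ᵐ p ∂(volume : Measure ℝ).prod μ, p.2 ∈ Set.Ioc (0 : ℝ) 1 :=
      Measure.quasiMeasurePreserving_snd.ae (ae_restrict_mem measurableSet_Ioc)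
    filter_upwards [this] with p hp
    rw [norm_mul]
    exact mul_le_mul_of_nonneg_right (norm_pow_mul_le hC p.1 hp.1) (norm_nonneg _)
  have e : T φ = ∫ s in Set.Ioc (0 : ℝ) 1, (s : ℂ) ^ N * linePairing h φ s := by
    rw [hT]
    calc _ = ∫ x : ℝ, ∫ s : ℝ, ((s : ℂ) ^ N * h (x + s * I)) * (φ x : ℂ) ∂μ := by
          simp only [integral_mul_const]
      _ = ∫ s : ℝ, ∫ x : ℝ, ((s : ℂ) ^ N * h (x + s * I)) * (φ x : ℂ) ∂volume ∂μ :=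
          integral_integral_swap hint
      _ = _ := by
          simp only [linePairing, ← integral_const_mul, mul_assoc]
          rfl
  rw [e]
  exact tendsto_heightIntegral hh hC φ

lemma exists_distrib_linePairing_one (hh : TemperedGrowth h) :
    ∃ T : ComplexDistrib, ∀ φ, T φ = linePairing h φ 1 :=
  exists_distrib_of_locallyIntegrable (hh.continuous_line one_pos).locallyIntegrable

/-- The recursion in k writes the lower integral through the height-1 pairing and the higher
integral of φ', so the limit is a combination of a distribution and a derivative of one. -/
lemma exists_distrib_step (hh : TemperedGrowth h) {k : ℕ}
    (H : ∃ T : ComplexDistrib, ∀ φ, Tendsto (heightIntegral h (k + 1) φ) (𝓝[>] 0) (𝓝 (T φ))) :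
    ∃ T : ComplexDistrib, ∀ φ, Tendsto (heightIntegral h k φ) (𝓝[>] 0) (𝓝 (T φ)) := by
  obtain ⟨T, hT⟩ := H
  obtain ⟨E, hE⟩ := exists_distrib_linePairing_one hh
  have hk : (k + 1 : ℂ) ≠ 0 := by exact_mod_cast Nat.succ_ne_zero k
  obtain ⟨S, hS⟩ := exists_distrib_combination ((k + 1 : ℂ)⁻¹) ((k + 1 : ℂ)⁻¹ * I) E T
  refine ⟨S, fun φ => ?_⟩
  rw [hS, hE]
  have h1 : Tendsto (fun y : ℝ => ((1 - y : ℝ) : ℂ) ^ (k + 1)) (𝓝[>] 0) (𝓝 1) := by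
    have : Continuous fun y : ℝ => ((1 - y : ℝ) : ℂ) ^ (k + 1) := by fun_prop
    simpa using (this.tendsto 0).mono_left nhdsWithin_le_nhds
  have h2 := ((h1.mul_const (linePairing h φ 1)).const_mul ((k + 1 : ℂ)⁻¹)).add
    ((hT (testDeriv φ)).const_mul ((k + 1 : ℂ)⁻¹ * I))
  rw [one_mul] at h2
  refine h2.congr' ?_
  filter_upwards [Ioc_mem_nhdsGT (zero_lt_one' ℝ)] with y hy
  have := hh.heightIntegral_succ k φ hy.1 hy.2
  field_simp
  linear_combination -this

lemma exists_distrib_heightIntegral (hh : TemperedGrowth h) (k : ℕ)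
    (H : ∃ T : ComplexDistrib, ∀ φ, Tendsto (heightIntegral h k φ) (𝓝[>] 0) (𝓝 (T φ))) :
    ∃ T : ComplexDistrib, ∀ φ, Tendsto (heightIntegral h 0 φ) (𝓝[>] 0) (𝓝 (T φ)) := by
  induction k with
  | zero => exact H
  | succ k ih => exact ih (exists_distrib_step hh H)

/-- Holomorphic functions of tempered growth have distributional boundary values. -/
lemma TemperedGrowth.exists_isBoundaryValue (hh : TemperedGrowth h) :
    ∃ T : ComplexDistrib, IsBoundaryValue h T := by
  obtain ⟨-, N, -, C, hC⟩ := id hh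
  obtain ⟨T, hT⟩ := exists_distrib_heightIntegral hh N (exists_distrib_base hh hC)
  obtain ⟨E, hE⟩ := exists_distrib_linePairing_one hh
  obtain ⟨S, hS⟩ := exists_distrib_combination 1 I E T
  refine ⟨S, fun φ => ⟨?_, ?_⟩⟩
  · filter_upwards [self_mem_nhdsWithin] with y hy
    exact continuous_mul_test_integrable (hh.continuous_line hy) φ
  · rw [hS, hE, one_mul]
    refine ((hT (testDeriv φ)).const_mul I |>.const_add (linePairing h φ 1)).congr' ?_
    filter_upwards [Ioc_mem_nhdsGT (zero_lt_one' ℝ)] with y hy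
    exact (hh.linePairing_eq φ hy.1 hy.2).symm

end

/-! ### Assembling the solution -/

lemma IsBoundaryValue.add {g₁ g₂ g : ℂ → ℂ} {T₁ T₂ : ComplexDistrib} (h₁ : IsBoundaryValue g₁ T₁)
    (h₂ : IsBoundaryValue g₂ T₂) (hg : ∀ z ∈ upperPlane, g z = g₁ z + g₂ z) :
    IsBoundaryValue g (T₁ + T₂) := by
  intro φ
  have e : ∀ {y : ℝ}, 0 < y → (fun x : ℝ => g (x + y * I) * (φ x : ℂ)) =
      fun x : ℝ => g₁ (x + y * I) * (φ x : ℂ) + g₂ (x + y * I) * (φ x : ℂ) := fun {y} hy => by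
    funext x
    rw [hg _ (by simpa [upperPlane] using hy), add_mul]
  refine ⟨?_, ?_⟩
  · filter_upwards [self_mem_nhdsWithin, (h₁ φ).1, (h₂ φ).1] with y hy i₁ i₂
    rw [e hy]
    exact i₁.add i₂
  · refine ((h₁ φ).2.add (h₂ φ).2).congr' ?_
    filter_upwards [self_mem_nhdsWithin, (h₁ φ).1, (h₂ φ).1] with y hy i₁ i₂
    rw [linePairing, linePairing, linePairing, e hy, integral_add i₁ i₂]

section

variable {q : ℝ} {f h : ℂ → ℂ}

/-- The difference between the solution and `h`; it is purely imaginary on the real line. -/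
noncomputable def solutionCorrection (f h : ℂ → ℂ) (c : ℝ) (z : ℂ) : ℂ :=
  (I * ((c - (h I).im : ℝ) : ℂ)) + schwarzT f z

lemma continuous_solutionCorrection (hq : 2 < q) (hf : PotentialDensity q f upperPlane) (c : ℝ) :
    Continuous (solutionCorrection f h c) :=
  continuous_const.add (continuous_schwarzT hq hf)

lemma schwarzSolution_eq (hh : TemperedGrowth h) (c : ℝ) {z : ℂ} (hz : z ∈ upperPlane) :
    schwarzSolution f h c z = h z + solutionCorrection f h c z := by
  rw [schwarzSolution, hh.poissonOfBoundary_eq hz, hh.imCorrection_eq, solutionCorrection]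
  push_cast
  ring

lemma continuousOn_schwarzSolution (hq : 2 < q) (hf : PotentialDensity q f upperPlane)
    (hh : TemperedGrowth h) (c : ℝ) : ContinuousOn (schwarzSolution f h c) upperPlane :=
  (hh.1.continuousOn.add (continuous_solutionCorrection hq hf c).continuousOn).congr fun _ hz =>
    schwarzSolution_eq hh c hz

lemma PotentialDensity.locallyIntegrableOn (hq : 2 < q) (hf : PotentialDensity q f upperPlane) :
    LocallyIntegrableOn f upperPlane := by
  have hF := hf.indicator (by linarith)
  intro z _
  refine ⟨Metric.ball 0 (‖z‖ + 1) ∩ upperPlane, inter_mem (mem_nhdsWithin_of_mem_nhds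
    (Metric.isOpen_ball.mem_nhds (by simp))) self_mem_nhdsWithin, ?_⟩
  have h1 := (integrable_indicator_iff measurableSet_ball).1 (hF.near_integrable (‖z‖ + 1))
  exact (h1.mono_set Set.inter_subset_left).congr_fun
    (fun w hw => Set.indicator_of_mem hw.2 f) (measurableSet_ball.inter measurableSet_upperPlane)

lemma hasWeakDbar_schwarzSolution (hq : 2 < q) (hf : PotentialDensity q f upperPlane)
    (hh : TemperedGrowth h) (c : ℝ) : HasWeakDbar (schwarzSolution f h c) f := by
  refine ⟨(continuousOn_schwarzSolution hq hf hh c).locallyIntegrableOn measurableSet_upperPlane,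
    hf.locallyIntegrableOn hq, fun φ hφ hc hs => ?_⟩
  have hdc := continuous_dbar hφ
  have hds := hasCompactSupport_dbar hc
  have hi : ∀ {k : ℂ → ℂ}, ContinuousOn k upperPlane →
      IntegrableOn (fun z => k z * dbar φ z) upperPlane := fun {k} hk => by
    have h1 : IntegrableOn (fun z => k z * dbar φ z) (tsupport φ) :=
      ((hk.mono hs).mul hdc.continuousOn).integrableOn_compact hc
    refine h1.of_forall_sdiff_eq_zero measurableSet_upperPlane fun z hz => ?_
    rw [dbar_eq_zero_of_notMem_tsupport hz.2, mul_zero]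
  have hconst : DifferentiableOn ℂ (fun z => h z + I * ((c - (h I).im : ℝ) : ℂ)) upperPlane :=
    hh.1.add_const _
  have e : ∫ z in upperPlane, schwarzSolution f h c z * dbar φ z =
      ∫ z in upperPlane, ((h z + I * ((c - (h I).im : ℝ) : ℂ)) * dbar φ z +
        schwarzT f z * dbar φ z) := by
    refine setIntegral_congr_fun measurableSet_upperPlane fun z hz => ?_
    simp only [schwarzSolution_eq hh c hz, solutionCorrection]
    ring
  rw [e, integral_add (hi hconst.continuousOn) (hi (continuous_schwarzT hq hf).continuousOn),
    integral_holomorphic_mul_dbar hconst hφ hc hs, integral_schwarzT_mul_dbar hq hf hφ hc hs,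
    zero_add]

lemma exists_boundary_schwarzSolution (hq : 2 < q) (hf : PotentialDensity q f upperPlane)
    (hh : TemperedGrowth h) (c : ℝ) : ∃ wb hb : ComplexDistrib,
    IsBoundaryValue (schwarzSolution f h c) wb ∧ IsBoundaryValue h hb ∧
      distribRe wb = distribRe hb := by
  obtain ⟨hb, hhb⟩ := hh.exists_isBoundaryValue
  obtain ⟨T, hT, hTφ⟩ :=
    exists_isBoundaryValue_of_continuous (continuous_solutionCorrection (h := h) hq hf c)
  refine ⟨hb + T, hb, hhb.add hT fun z hz => schwarzSolution_eq hh c hz, hhb, ?_⟩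
  -- The boundary value of the correction is integration against a continuous, purely imaginary
  -- function, paired with real φ.
  have hre : ∀ φ, (T φ).re = 0 := by
    intro φ
    rw [hTφ]
    have hint := continuous_mul_test_integrable
      ((continuous_solutionCorrection (h := h) hq hf c).comp continuous_ofReal) φ
    rw [← Complex.reCLM_apply]
    refine (Complex.reCLM.integral_comp_comm hint).symm.trans ?_
    refine integral_eq_zero_of_ae (Eventually.of_forall fun x => ?_)
    simp [solutionCorrection, schwarzT_ofReal_re hq hf]
  ext φ
  change ((hb φ + T φ)).re = (hb φ).re
  rw [Complex.add_re, hre, add_zero]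

lemma schwarzSolution_I_im (hq : 2 < q) (hf : PotentialDensity q f upperPlane)
    (hh : TemperedGrowth h) (c : ℝ) : (schwarzSolution f h c I).im = c := by
  rw [schwarzSolution_eq hh c I_mem_upperPlane, solutionCorrection, add_im, add_im,
    schwarzT_I_im hq hf]
  simp

end

end SchwarzUHP

theorem mainTheorem6 (p : ℝ≥0∞) (hp : 2 < p) (f : ℂ → ℂ) (hf : SchwarzUHP.MemLpNu p 2 f)
    (h : ℂ → ℂ) (hh : SchwarzUHP.TemperedGrowth h) (c : ℝ) :
    -- the pairings of `h_b` with the Poisson kernel are well defined and represent `h`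
    (∀ z ∈ SchwarzUHP.upperPlane,
      SchwarzUHP.HasBoundaryPairing h (fun t => SchwarzUHP.poissonP (z.re - t) z.im)
        (SchwarzUHP.boundaryPairing h (fun t => SchwarzUHP.poissonP (z.re - t) z.im)) ∧
      h z = SchwarzUHP.poissonOfBoundary h z) ∧
    SchwarzUHP.HasBoundaryPairing h (fun t => SchwarzUHP.poissonP t 1)
      (SchwarzUHP.boundaryPairing h (fun t => SchwarzUHP.poissonP t 1)) ∧
    -- the integral defining the operator applied to `f` converges absolutely
    (∀ z ∈ SchwarzUHP.upperPlane,
      IntegrableOn (SchwarzUHP.schwarzKernel f z) SchwarzUHP.upperPlane) ∧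
    -- the two expressions for the solution agree
    (∀ z ∈ SchwarzUHP.upperPlane,
      SchwarzUHP.schwarzSolution f h c z =
        I * (c : ℂ) + h z - SchwarzUHP.imCorrection h + SchwarzUHP.schwarzT f z) ∧
    -- it solves the boundary value problem
    SchwarzUHP.IsSchwarzSolution f h c (SchwarzUHP.schwarzSolution f h c) := by
  obtain ⟨q, hq, hd⟩ := hf.exists_density hp
  have hpair : ∀ z ∈ SchwarzUHP.upperPlane,
      SchwarzUHP.HasBoundaryPairing h (fun t => SchwarzUHP.poissonP (z.re - t) z.im)
        (SchwarzUHP.boundaryPairing h (fun t => SchwarzUHP.poissonP (z.re - t) z.im)) :=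
    fun z hz => by
      rw [hh.boundaryPairing_eq hz]
      exact hh.hasBoundaryPairing hz
  refine ⟨fun z hz => ⟨hpair z hz, (hh.poissonOfBoundary_eq hz).symm⟩, ?_,
    fun z _ => SchwarzUHP.integrableOn_schwarzKernel hq hd z, fun z hz => ?_,
    SchwarzUHP.continuousOn_schwarzSolution hq hd hh c,
    SchwarzUHP.hasWeakDbar_schwarzSolution hq hd hh c,
    SchwarzUHP.exists_boundary_schwarzSolution hq hd hh c,
    SchwarzUHP.schwarzSolution_I_im hq hd hh c⟩
  · have := hpair I SchwarzUHP.I_mem_upperPlane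
    rwa [SchwarzUHP.poissonP_I_sub] at this
  · rw [SchwarzUHP.schwarzSolution, hh.poissonOfBoundary_eq hz]
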